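/- Let $n\ge 1$ be an integer. For $1\le p\le\infty$ let $\mathring W^n_p[0;1]$ be the space of real functions $y$ on $[0,1]$ whose derivatives of orders $0,\dots,n-1$ are absolutely continuous, with $y^{(n)}\in L_p[0,1]$ and $y^{(j)}(0)=y^{(j)}(1)=0$ for $j=0,\dots,n-1$. For $0\le k\le n-1$ and $a\in[0,1]$ let $A_{n,k,p}(a)$ be the least constant in the inequality $$|y^{(k)}(a)|\le A_{n,k,p}(a)\,\|y^{(n)}\|_{L_p[0,1]},\qquad y\in\mathring W^n_p[0;1],$$ and let $\Lambda_{n,k,p,q}=\sup\{\|y^{(k)}\|_{L_q[0,1]}:\ y\in\mathring W^n_p[0;1],\ \|y^{(n)}\|_{L_p[0,1]}=1\}$. Put $B_n(a)=\tan\frac{\pi}{2(n+1)}\sqrt{a-a^2}$. Then: (1) The points of local maximum of the function $A_{n,n-1,\infty}$ on $[0,1]$ are exactly $a_j=\sin^2\frac{\pi j}{2(n+1)}$, $j=1,\dots,n$. (2) $A_{n,n-1,\infty}(a_j)=B_n(a_j)$ for $j=1,\dots,n$. (3) If $n$ is odd, the only point of global maximum of $A_{n,n-1,\infty}$ on $[0,1]$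 is $a=\frac12$. If $n$ is even, the points of global maximum are exactly the points of local maximum nearest to $\frac12$, which are $\sin^2\frac{\pi n}{4(n+1)}$ and $\sin^2\frac{\pi(n+2)}{4(n+1)}$. (4) Consequently $$\Lambda_{n,n-1,\infty,\infty}=\tfrac12\tan\tfrac{\pi}{2(n+1)}\ \text{ if } n \text{ is odd},\qquad \Lambda_{n,n-1,\infty,\infty}=\tfrac12\tan\tfrac{\pi}{2(n+1)}\,\sin\tfrac{\pi n}{2(n+1)}\ \text{ if } n \text{ is even}.$$ -/

import Mathlib

open Set MeasureTheory
open scoped ENNReal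

/-- The `j`-th derivative of `y` on the segment `[0, 1]` (one-sided at the end points). -/
noncomputable def segDeriv (j : ℕ) (y : ℝ → ℝ) : ℝ → ℝ :=
  iteratedDerivWithin j y (Icc (0 : ℝ) 1)

/-- The norm of `L_p[0, 1]`, with values in `[0, ∞]`; for `p = ∞` it is the essential supremum of
the absolute value over `[0, 1]`. -/
noncomputable def segNorm (p : ℝ≥0∞) (f : ℝ → ℝ) : ℝ≥0∞ :=
  eLpNorm f p (volume.restrict (Icc (0 : ℝ) 1))

/-- Membership in the Sobolev space `W̊ⁿ_p[0, 1]`: the derivatives of orders `0, …, n - 1` exist on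
`[0, 1]` and are absolutely continuous there, the `n`-th derivative (which then exists almost
everywhere) is in `L_p[0, 1]`, and the derivatives of orders `0, …, n - 1` vanish at `0` and `1`.
Only the values of `y` on `[0, 1]` matter. -/
structure MemSobolevZero (n : ℕ) (p : ℝ≥0∞) (y : ℝ → ℝ) : Prop where
  differentiableOn : ∀ j : ℕ, j + 1 < n → DifferentiableOn ℝ (segDeriv j y) (Icc 0 1)
  absolutelyContinuous : ∀ j : ℕ, j < n → AbsolutelyContinuousOnInterval (segDeriv j y) 0 1
  memLp : MemLp (segDeriv n y) p (volume.restrict (Icc (0 : ℝ) 1))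
  left_eq_zero : ∀ j : ℕ, j < n → segDeriv j y 0 = 0
  right_eq_zero : ∀ j : ℕ, j < n → segDeriv j y 1 = 0

/-- `A_{n,k,p}(a)`: the least constant `C` with `|y⁽ᵏ⁾(a)| ≤ C ‖y⁽ⁿ⁾‖_{L_p[0, 1]}` for all `y` in
`W̊ⁿ_p[0, 1]`, as an element of `[0, ∞]`. -/
noncomputable def pointConst (n k : ℕ) (p : ℝ≥0∞) (a : ℝ) : ℝ≥0∞ :=
  sInf {C : ℝ≥0∞ | ∀ y : ℝ → ℝ, MemSobolevZero n p y →
    ENNReal.ofReal |segDeriv k y a| ≤ C * segNorm p (segDeriv n y)}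

/-- `Λ_{n,k,p,q}`: the supremum of `‖y⁽ᵏ⁾‖_{L_q[0, 1]}` over all `y` in `W̊ⁿ_p[0, 1]` with
`‖y⁽ⁿ⁾‖_{L_p[0, 1]} = 1`, as an element of `[0, ∞]`. -/
noncomputable def embeddingConst (n k : ℕ) (p q : ℝ≥0∞) : ℝ≥0∞ :=
  sSup {r : ℝ≥0∞ | ∃ y : ℝ → ℝ, MemSobolevZero n p y ∧ segNorm p (segDeriv n y) = 1 ∧
    r = segNorm q (segDeriv k y)}

/-- The function `B_n(a) = tan (π / (2 (n + 1))) √(a - a²)`. -/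
noncomputable def envelopeB (n : ℕ) (a : ℝ) : ℝ :=
  Real.tan (Real.pi / (2 * ((n : ℝ) + 1))) * √(a - a ^ 2)

/-- The points of `[0, 1]` at which `f` has a local maximum relative to `[0, 1]`. -/
def localMaxPoints (f : ℝ → ℝ≥0∞) : Set ℝ :=
  {a | a ∈ Icc (0 : ℝ) 1 ∧ IsLocalMaxOn f (Icc 0 1) a}

/-- The points of `[0, 1]` at which `f` attains its global maximum over `[0, 1]`. -/
def globalMaxPoints (f : ℝ → ℝ≥0∞) : Set ℝ :=
  {a | a ∈ Icc (0 : ℝ) 1 ∧ IsMaxOn f (Icc 0 1) a}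

/-! Write `A` for `A_{n,n-1,∞}` and `χ` for the indicator of `(-∞, a]`. The boundary conditions make
`y⁽ⁿ⁾` orthogonal to all polynomials `p` of degree less than `n`, so `y⁽ⁿ⁻¹⁾(a) = ∫ y⁽ⁿ⁾ (χ - p)`,
and `A(a)` is at most the `L₁` error of approximating `χ` by `p` (`pointConst_le_integral`).
Conversely, a sign function orthogonal to these polynomials is the `n`-th derivative of an
admissible `y`, and its integral over `[0, a]` bounds `A(a)` from below
(`ofReal_abs_integral_signFn_le_pointConst`). The bounds coincide when `a` is one of the sign
changes and `p` interpolates `χ` at the others, because the interpolation error then changes sign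
exactly at those points (`stepFn_sub_eval_mul_nonneg`).

Orthogonal sign functions amount to alternating quadrature formulas (`AlternatingNodes`), obtained
from partial fractions of `Q l / (X (1 - X) W)` (`WeightedNodes.sum_eq`). Two sources of `W` are
needed. The Chebyshev polynomial `U_n`, moved to `[0, 1]`, has the `n` roots `a_j`. A one-parameter
family `zolotarevPoly n s`, `s > 0`, has `n + 1` roots, the `i`-th one sweeping the open interval
between the Chebyshev nodes `i - 1` and `i` (the end points counted as nodes). Thus every interior
`a` is covered, and `A(a)` is an alternating sum of nodes; at `a_j` it telescopes to `B_n(a_j)`.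

At `a = a_j` there is freedom in the interpolant: either end point may be the missing `n`-th
condition. One choice has `p(a) < 1/2`, the other `p(a) > 1/2`. Moving the jump of `χ` left does not
increase the error of the first, moving it right does not increase that of the second, so `a_j` is a
local maximum (`isLocalMaxOn_pointConst_chebNode`).

At any other interior `a`, follow the alternating sum along the family. If `a` were a local maximum,
this sum would have a local maximum in `s`. The first-order condition is `p(a) = 1/2`; the
second-order coefficient is then strictly positive, by concavity of `x (1 - x) / l(x)`
(`sum_derivative_mul_weight_sq_pos`), a contradiction. Finally `A` is Lipschitz, so it attains its
maximum, at some `a_j`, and `B_n` decreases with the distance to `1/2`. -/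

open Polynomial in
/-- A real polynomial has an antiderivative vanishing at `0`. -/
theorem Polynomial.exists_derivative_eq (q : ℝ[X]) {d : ℕ} (hq : q.degree < d) :
    ∃ Q : ℝ[X], derivative Q = q ∧ Q.degree < (d + 1 : ℕ) ∧ Q.eval 0 = 0 := by
  by_cases h0 : q = 0
  · exact ⟨0, by simp [h0], by simp, by simp⟩
  have hd : q.natDegree < d := (natDegree_lt_iff_degree_lt h0).2 hq
  refine ⟨∑ k ∈ Finset.range d, C (q.coeff k / (k + 1)) * X ^ (k + 1), ?_, ?_, ?_⟩
  · rw [derivative_sum]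
    conv_rhs => rw [q.as_sum_range' d hd]
    refine Finset.sum_congr rfl fun k _ => ?_
    rw [derivative_C_mul_X_pow, ← C_mul_X_pow_eq_monomial, Nat.add_sub_cancel]
    congr 2
    push_cast
    field_simp
  · refine (degree_sum_le _ _).trans_lt ?_
    rw [Finset.sup_lt_iff (by exact WithBot.bot_lt_coe _)]
    intro k hk
    refine (degree_C_mul_X_pow_le _ _).trans_lt ?_
    exact_mod_cast Nat.succ_lt_succ (Finset.mem_range.1 hk)
  · simp [eval_finsetSum]

/-! ### Derivatives on the segment and orthogonality to polynomials -/

theorem uniqueDiffOn_unitInterval : UniqueDiffOn ℝ (Icc (0 : ℝ) 1) :=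
  uniqueDiffOn_Icc zero_lt_one

theorem segDeriv_succ (j : ℕ) (y : ℝ → ℝ) :
    segDeriv (j + 1) y = derivWithin (segDeriv j y) (Icc 0 1) :=
  iteratedDerivWithin_succ

/-- No differentiability is required: where the derivative does not exist, both sides take the same
default value. -/
theorem segDeriv_succ_eq_deriv (j : ℕ) (y : ℝ → ℝ) {x : ℝ} (hx : x ∈ Ioo (0 : ℝ) 1) :
    segDeriv (j + 1) y x = deriv (segDeriv j y) x := by
  rw [segDeriv_succ, derivWithin_of_mem_nhds (Icc_mem_nhds hx.1 hx.2)]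

theorem ae_mem_uIoc_imp_of_Ioo {P : ℝ → Prop} {a b : ℝ} (hab : a ≤ b)
    (h : ∀ x ∈ Ioo a b, P x) : ∀ᵐ x, x ∈ uIoc a b → P x := by
  filter_upwards [compl_mem_ae_iff.2 (measure_singleton b)] with x hx hx'
  rw [uIoc_of_le hab] at hx'
  exact h x ⟨hx'.1, lt_of_le_of_ne hx'.2 hx⟩

theorem Polynomial.absolutelyContinuousOnInterval (q : Polynomial ℝ) (a b : ℝ) :
    AbsolutelyContinuousOnInterval (fun x => q.eval x) a b :=
  (Polynomial.contDiff_aeval q 1).contDiffOn.absolutelyContinuousOnInterval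

theorem MemSobolevZero.integral_segDeriv {n : ℕ} {p : ℝ≥0∞} {y : ℝ → ℝ}
    (hy : MemSobolevZero n p y) {j : ℕ} (hj : j < n) {a b : ℝ} (ha : 0 ≤ a) (hab : a ≤ b)
    (hb : b ≤ 1) :
    ∫ t in a..b, segDeriv (j + 1) y t = segDeriv j y b - segDeriv j y a := by
  have h : AbsolutelyContinuousOnInterval (segDeriv j y) a b := by
    refine (hy.absolutelyContinuous j hj).mono ?_
    rw [uIcc_of_le hab, uIcc_of_le zero_le_one]
    exact Icc_subset_Icc ha hb
  rw [← h.integral_deriv_eq_sub]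
  refine intervalIntegral.integral_congr_ae (ae_mem_uIoc_imp_of_Ioo hab fun x hx => ?_)
  exact segDeriv_succ_eq_deriv j y ⟨ha.trans_lt hx.1, hx.2.trans_le hb⟩

/-- The derivative of order `j` of a function in the Sobolev space is orthogonal to the polynomials
of degree less than `j`. -/
theorem MemSobolevZero.integral_segDeriv_mul_eval {n : ℕ} {p : ℝ≥0∞} {y : ℝ → ℝ}
    (hy : MemSobolevZero n p y) {j : ℕ} (hj : j ≤ n) (q : Polynomial ℝ) (hq : q.degree < j) :
    ∫ t in (0 : ℝ)..1, segDeriv j y t * q.eval t = 0 := by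
  induction j generalizing q with
  | zero =>
    have : q = 0 := by
      rw [← Polynomial.degree_eq_bot]
      exact (Nat.WithBot.lt_zero_iff).1 (by simpa using hq)
    simp [this]
  | succ j ih =>
    by_cases h0 : q = 0
    · simp [h0]
    have hq' : q.derivative.degree < j := by
      have h1 := Polynomial.degree_derivative_lt h0
      rw [Polynomial.degree_eq_natDegree h0] at h1 hq
      refine h1.trans_le ?_
      have : q.natDegree < j + 1 := by exact_mod_cast hq
      exact_mod_cast Nat.lt_succ_iff.1 this
    have h2 := ih (by omega) q.derivative hq'
    have h3 := (hy.absolutelyContinuous j (by omega)).integral_mul_deriv_eq_deriv_mul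
      (q.absolutelyContinuousOnInterval 0 1)
    simp only [Polynomial.deriv] at h3
    rw [h2, hy.left_eq_zero j (by omega), hy.right_eq_zero j (by omega)] at h3
    have h4 : ∫ t in (0 : ℝ)..1, segDeriv (j + 1) y t * q.eval t =
        ∫ t in (0 : ℝ)..1, deriv (segDeriv j y) t * q.eval t := by
      refine intervalIntegral.integral_congr_ae (ae_mem_uIoc_imp_of_Ioo zero_le_one fun x hx => ?_)
      rw [segDeriv_succ_eq_deriv j y hx]
    rw [h4]
    linarith

theorem MemSobolevZero.ae_abs_segDeriv_le {n : ℕ} {y : ℝ → ℝ} (hy : MemSobolevZero n ⊤ y) :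
    ∀ᵐ t ∂(volume.restrict (Icc (0 : ℝ) 1)),
      |segDeriv n y t| ≤ (segNorm ⊤ (segDeriv n y)).toReal := by
  have hfin : segNorm ⊤ (segDeriv n y) ≠ ⊤ := hy.memLp.eLpNorm_ne_top
  have h := ae_le_eLpNormEssSup (f := segDeriv n y) (μ := volume.restrict (Icc (0 : ℝ) 1))
  rw [segNorm, eLpNorm_exponent_top] at *
  filter_upwards [h] with t ht
  rw [← Real.norm_eq_abs, ← toReal_enorm]
  exact ENNReal.toReal_mono hfin ht

theorem MemSobolevZero.intervalIntegrable {n : ℕ} {y : ℝ → ℝ} (hy : MemSobolevZero n ⊤ y) :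
    IntervalIntegrable (segDeriv n y) volume 0 1 := by
  rw [intervalIntegrable_iff_integrableOn_Icc_of_le zero_le_one]
  exact hy.memLp.integrable le_top

/-! ### Upper bounds: approximation of a step function in `L₁` -/

/-- The step function `1` on `(-∞, a]`, `0` on `(a, ∞)`. -/
noncomputable def stepFn (a : ℝ) : ℝ → ℝ := (Iic a).indicator 1

theorem stepFn_of_le {a x : ℝ} (h : x ≤ a) : stepFn a x = 1 := by
  simp [stepFn, h]

theorem stepFn_of_lt {a x : ℝ} (h : a < x) : stepFn a x = 0 := by
  simp [stepFn, h]

theorem intervalIntegrable_stepFn (a b c : ℝ) : IntervalIntegrable (stepFn a) volume b c := by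
  have : AntitoneOn (stepFn a) (uIcc b c) := by
    intro x _ y _ hxy
    by_cases h : y ≤ a
    · rw [stepFn_of_le h, stepFn_of_le (hxy.trans h)]
    · rw [stepFn_of_lt (not_le.1 h)]
      exact indicator_nonneg (by simp) x
  exact this.intervalIntegrable

theorem integral_mul_stepFn {u : ℝ → ℝ} (hu : IntervalIntegrable u volume 0 1) {a : ℝ}
    (ha : a ∈ Icc (0 : ℝ) 1) :
    IntervalIntegrable (fun t => u t * stepFn a t) volume 0 1 ∧
    ∫ t in (0 : ℝ)..1, u t * stepFn a t = ∫ t in (0 : ℝ)..a, u t := by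
  have e : (fun t => u t * stepFn a t) = (Iic a).indicator u := by
    ext t
    by_cases h : t ≤ a <;> simp [stepFn, h]
  rw [e]
  constructor
  · rw [intervalIntegrable_iff] at hu ⊢
    exact hu.indicator measurableSet_Iic
  · rw [intervalIntegral.integral_of_le zero_le_one, intervalIntegral.integral_of_le ha.1,
      setIntegral_indicator measurableSet_Iic, Ioc_inter_Iic, min_eq_right ha.2]

/-- Approximating the step function at `a` by polynomials bounds `A_{n,n-1,∞}(a)` from above. -/
theorem pointConst_le_integral {n : ℕ} (hn : 1 ≤ n) {a : ℝ} (ha : a ∈ Icc (0 : ℝ) 1)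
    (p : Polynomial ℝ) (hp : p.degree < n) :
    pointConst n (n - 1) ⊤ a ≤
      ENNReal.ofReal (∫ t in (0 : ℝ)..1, |stepFn a t - p.eval t|) := by
  refine sInf_le fun y hy => ?_
  set M := (segNorm ⊤ (segDeriv n y)).toReal
  have hfin : segNorm ⊤ (segDeriv n y) ≠ ⊤ := hy.memLp.eLpNorm_ne_top
  have hu := hy.intervalIntegrable
  have hpi : IntervalIntegrable (fun t => segDeriv n y t * p.eval t) volume 0 1 :=
    hu.mul_continuousOn p.continuous.continuousOn
  have h1 : segDeriv (n - 1) y a = ∫ t in (0 : ℝ)..a, segDeriv n y t := by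
    have := hy.integral_segDeriv (j := n - 1) (by omega) le_rfl ha.1 ha.2
    rw [Nat.sub_add_cancel hn, hy.left_eq_zero _ (by omega), sub_zero] at this
    exact this.symm
  -- Integrating over `[0, a]` is pairing with the step function; orthogonality then allows `p` to
  -- be subtracted for free.
  have h2 := integral_mul_stepFn hu ha
  have h3 : segDeriv (n - 1) y a =
      ∫ t in (0 : ℝ)..1, segDeriv n y t * (stepFn a t - p.eval t) := by
    simp only [mul_sub]
    rw [intervalIntegral.integral_sub h2.1 hpi, h2.2,
      hy.integral_segDeriv_mul_eval le_rfl p hp, sub_zero, h1]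
  have hint : IntervalIntegrable (fun t => |stepFn a t - p.eval t|) volume 0 1 :=
    ((intervalIntegrable_stepFn a 0 1).sub (p.continuous.intervalIntegrable 0 1)).abs
  have h4 : |segDeriv (n - 1) y a| ≤ (∫ t in (0 : ℝ)..1, |stepFn a t - p.eval t|) * M := by
    rw [h3, ← intervalIntegral.integral_mul_const]
    rw [← Real.norm_eq_abs]
    refine intervalIntegral.norm_integral_le_of_norm_le zero_le_one ?_ (hint.mul_const M)
    have := hy.ae_abs_segDeriv_le
    rw [ae_restrict_iff' measurableSet_Icc] at this
    filter_upwards [this] with t ht ht'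
    rw [Real.norm_eq_abs, abs_mul, mul_comm]
    exact mul_le_mul_of_nonneg_left (ht (Ioc_subset_Icc_self ht')) (abs_nonneg _)
  calc ENNReal.ofReal |segDeriv (n - 1) y a|
      ≤ ENNReal.ofReal ((∫ t in (0 : ℝ)..1, |stepFn a t - p.eval t|) * M) :=
        ENNReal.ofReal_le_ofReal h4
    _ = _ := by
        rw [ENNReal.ofReal_mul' ENNReal.toReal_nonneg, ENNReal.ofReal_toReal hfin]

theorem le_pointConst_of_memSobolevZero {n k : ℕ} {p : ℝ≥0∞} {a : ℝ} {y : ℝ → ℝ}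
    (hy : MemSobolevZero n p y) (h1 : segNorm p (segDeriv n y) = 1) :
    ENNReal.ofReal |segDeriv k y a| ≤ pointConst n k p a := by
  refine le_sInf fun C hC => ?_
  simpa [h1] using hC y hy

/-- `A_{n,n-1,∞}` is Lipschitz. -/
theorem pointConst_le_add {n : ℕ} (hn : 1 ≤ n) {a b : ℝ} (ha : a ∈ Icc (0 : ℝ) 1)
    (hb : b ∈ Icc (0 : ℝ) 1) :
    pointConst n (n - 1) ⊤ a ≤ pointConst n (n - 1) ⊤ b + ENNReal.ofReal |a - b| := by
  rw [← tsub_le_iff_right]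
  refine le_sInf fun C hC => ?_
  rw [tsub_le_iff_right]
  refine sInf_le fun y hy => ?_
  have hfin : segNorm ⊤ (segDeriv n y) ≠ ⊤ := hy.memLp.eLpNorm_ne_top
  have key : ∀ c d : ℝ, 0 ≤ c → c ≤ d → d ≤ 1 →
      |segDeriv (n - 1) y d - segDeriv (n - 1) y c| ≤
        (segNorm ⊤ (segDeriv n y)).toReal * |d - c| := by
    intro c d hc hcd hd
    have := hy.integral_segDeriv (j := n - 1) (by omega) hc hcd hd
    rw [Nat.sub_add_cancel hn] at this
    rw [← this]
    rw [← Real.norm_eq_abs]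
    refine intervalIntegral.norm_integral_le_of_norm_le_const_ae ?_
    have h := hy.ae_abs_segDeriv_le
    rw [ae_restrict_iff' measurableSet_Icc] at h
    filter_upwards [h] with t ht ht'
    rw [uIoc_of_le hcd] at ht'
    exact ht ⟨hc.trans ht'.1.le, ht'.2.trans hd⟩
  have h1 : |segDeriv (n - 1) y a| ≤ |segDeriv (n - 1) y b| +
      (segNorm ⊤ (segDeriv n y)).toReal * |a - b| := by
    have : |segDeriv (n - 1) y a - segDeriv (n - 1) y b| ≤
        (segNorm ⊤ (segDeriv n y)).toReal * |a - b| := by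
      rcases le_total a b with h | h
      · rw [abs_sub_comm, abs_sub_comm a b]
        exact key a b ha.1 h hb.2
      · exact key b a hb.1 h ha.2
    have h2 := abs_sub_abs_le_abs_sub (segDeriv (n - 1) y a) (segDeriv (n - 1) y b)
    linarith
  calc ENNReal.ofReal |segDeriv (n - 1) y a|
      ≤ ENNReal.ofReal (|segDeriv (n - 1) y b| +
          (segNorm ⊤ (segDeriv n y)).toReal * |a - b|) := ENNReal.ofReal_le_ofReal h1
    _ = ENNReal.ofReal |segDeriv (n - 1) y b| +
          segNorm ⊤ (segDeriv n y) * ENNReal.ofReal |a - b| := by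
        rw [ENNReal.ofReal_add (abs_nonneg _) (by positivity),
          ENNReal.ofReal_mul ENNReal.toReal_nonneg, ENNReal.ofReal_toReal hfin]
    _ ≤ C * segNorm ⊤ (segDeriv n y) + segNorm ⊤ (segDeriv n y) * ENNReal.ofReal |a - b| := by
        gcongr
        exact hC y hy
    _ = _ := by ring

/-! ### Lower bounds: repeated primitives of orthogonal sign functions -/

theorem AbsolutelyContinuousOnInterval.congr_of_eqOn {f g : ℝ → ℝ} {a b : ℝ}
    (hg : AbsolutelyContinuousOnInterval g a b) (h : EqOn f g (uIcc a b)) :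
    AbsolutelyContinuousOnInterval f a b := by
  rw [absolutelyContinuousOnInterval_iff] at hg ⊢
  intro ε hε
  obtain ⟨δ, hδ, H⟩ := hg ε hε
  refine ⟨δ, hδ, fun E hE hE' => ?_⟩
  rw [Finset.sum_congr rfl fun i hi => ?_]
  · exact H E hE hE'
  · have := hE.1 i hi
    rw [h this.1, h this.2]

/-- The `j`-fold primitive of `f` with base point `0`. -/
noncomputable def iteratedPrimitive (f : ℝ → ℝ) : ℕ → ℝ → ℝ
  | 0 => f
  | j + 1 => fun x => ∫ t in (0 : ℝ)..x, iteratedPrimitive f j t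

section
variable {f : ℝ → ℝ} {S : Set ℝ}

theorem iteratedPrimitive_intervalIntegrable (hf : ∀ a b, IntervalIntegrable f volume a b) (j : ℕ) :
    ∀ a b, IntervalIntegrable (iteratedPrimitive f j) volume a b := by
  induction j with
  | zero => exact hf
  | succ j ih =>
    intro a b
    exact (intervalIntegral.continuous_primitive ih 0).intervalIntegrable a b

theorem continuous_iteratedPrimitive_succ (hf : ∀ a b, IntervalIntegrable f volume a b) (j : ℕ) :
    Continuous (iteratedPrimitive f (j + 1)) :=
  intervalIntegral.continuous_primitive (iteratedPrimitive_intervalIntegrable hf j) 0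

theorem hasDerivAt_iteratedPrimitive_succ (hf : ∀ a b, IntervalIntegrable f volume a b)
    (hm : Measurable f) (j : ℕ) {x : ℝ} (hx : 1 ≤ j ∨ ContinuousAt f x) :
    HasDerivAt (iteratedPrimitive f (j + 1)) (iteratedPrimitive f j x) x := by
  have hc : ContinuousAt (iteratedPrimitive f j) x := by
    rcases j with _ | j
    · exact hx.resolve_left (by omega)
    · exact (continuous_iteratedPrimitive_succ hf j).continuousAt
  have hm' : Measurable (iteratedPrimitive f j) := by
    rcases j with _ | j
    · exact hm
    · exact (continuous_iteratedPrimitive_succ hf j).measurable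
  exact intervalIntegral.integral_hasDerivAt_right
    (iteratedPrimitive_intervalIntegrable hf j 0 x)
    hm'.stronglyMeasurable.stronglyMeasurableAtFilter hc

theorem absolutelyContinuousOnInterval_iteratedPrimitive_succ
    (hf : ∀ a b, IntervalIntegrable f volume a b) (j : ℕ) :
    AbsolutelyContinuousOnInterval (iteratedPrimitive f (j + 1)) 0 1 :=
  (iteratedPrimitive_intervalIntegrable hf j 0 1).absolutelyContinuousOnInterval_intervalIntegral
    (by simp)

theorem iteratedPrimitive_succ_zero (j : ℕ) : iteratedPrimitive f (j + 1) 0 = 0 :=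
  intervalIntegral.integral_same

/-- Each primitive costs one degree of orthogonality, by integration by parts against an
antiderivative of `q`. This is what makes all the boundary values at `1` vanish. -/
theorem integral_iteratedPrimitive_mul_eval (hf : ∀ a b, IntervalIntegrable f volume a b)
    (hm : Measurable f) (hS : S.Finite) (hfS : ∀ x ∉ S, ContinuousAt f x) {n : ℕ}
    (horth : ∀ q : Polynomial ℝ, q.degree < n → ∫ t in (0 : ℝ)..1, f t * q.eval t = 0)
    (j : ℕ) (hj : j ≤ n) (q : Polynomial ℝ) (hq : q.degree < (n - j : ℕ)) :
    ∫ t in (0 : ℝ)..1, iteratedPrimitive f j t * q.eval t = 0 := by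
  induction j generalizing q with
  | zero => exact horth q hq
  | succ j ih =>
    obtain ⟨Q, hQ, hQd, -⟩ := q.exists_derivative_eq hq
    have hd : n - (j + 1) + 1 = n - j := by omega
    rw [hd] at hQd
    have h1 := ih (by omega) Q hQd
    have h2 := (absolutelyContinuousOnInterval_iteratedPrimitive_succ hf
      j).integral_mul_deriv_eq_deriv_mul (Q.absolutelyContinuousOnInterval 0 1)
    -- The boundary term at `1` is the pairing of the previous primitive with the constant `1`,
    -- still covered by the induction hypothesis.
    have h3 : iteratedPrimitive f (j + 1) 1 = 0 := by
      have := ih (by omega) 1 (by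
        rw [Polynomial.degree_one]
        exact_mod_cast (by omega : 0 < n - j))
      simp only [Polynomial.eval_one, mul_one] at this
      exact this
    have h4 : ∫ t in (0 : ℝ)..1, deriv (iteratedPrimitive f (j + 1)) t * Q.eval t =
        ∫ t in (0 : ℝ)..1, iteratedPrimitive f j t * Q.eval t := by
      refine intervalIntegral.integral_congr_ae ?_
      filter_upwards [compl_mem_ae_iff.2 (hS.measure_zero volume)] with x hx _
      rw [(hasDerivAt_iteratedPrimitive_succ hf hm j (Or.inr (hfS x hx))).deriv]
    simp only [Polynomial.deriv, hQ] at h2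
    rw [h4, h1, h3, iteratedPrimitive_succ_zero] at h2
    simpa using h2

theorem iteratedPrimitive_one (hf : ∀ a b, IntervalIntegrable f volume a b)
    (hm : Measurable f) (hS : S.Finite) (hfS : ∀ x ∉ S, ContinuousAt f x) {n : ℕ}
    (horth : ∀ q : Polynomial ℝ, q.degree < n → ∫ t in (0 : ℝ)..1, f t * q.eval t = 0)
    (j : ℕ) (hj : j < n) : iteratedPrimitive f (j + 1) 1 = 0 := by
  have := integral_iteratedPrimitive_mul_eval hf hm hS hfS horth j hj.le 1 (by
    rw [Polynomial.degree_one]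
    exact_mod_cast (by omega : 0 < n - j))
  simp only [Polynomial.eval_one, mul_one] at this
  exact this

theorem segDeriv_iteratedPrimitive (hf : ∀ a b, IntervalIntegrable f volume a b)
    (hm : Measurable f) {n : ℕ} (i : ℕ) (hi : i < n) :
    EqOn (segDeriv i (iteratedPrimitive f n)) (iteratedPrimitive f (n - i)) (Icc 0 1) := by
  induction i with
  | zero => intro x _; simp [segDeriv]
  | succ i ih =>
    intro x hx
    have e : n - i = (n - (i + 1)) + 1 := by omega
    rw [segDeriv_succ, derivWithin_congr (ih (by omega)) (ih (by omega) hx), e]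
    exact (hasDerivAt_iteratedPrimitive_succ hf hm _
      (Or.inl (by omega))).hasDerivWithinAt.derivWithin (uniqueDiffOn_unitInterval x hx)

theorem segDeriv_iteratedPrimitive_self (hf : ∀ a b, IntervalIntegrable f volume a b)
    (hm : Measurable f) {n : ℕ} (hn : 1 ≤ n) {x : ℝ} (hx : x ∈ Icc (0 : ℝ) 1)
    (hc : ContinuousAt f x) : segDeriv n (iteratedPrimitive f n) x = f x := by
  obtain ⟨n, rfl⟩ : ∃ m, n = m + 1 := ⟨n - 1, by omega⟩
  have h := segDeriv_iteratedPrimitive hf hm n (Nat.lt_succ_self n)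
  have e : n + 1 - n = 0 + 1 := by omega
  rw [segDeriv_succ, derivWithin_congr h (h hx), e]
  exact (hasDerivAt_iteratedPrimitive_succ hf hm 0
    (Or.inr hc)).hasDerivWithinAt.derivWithin (uniqueDiffOn_unitInterval x hx)

/-- A function with values `±1` orthogonal to the polynomials of degree less than `n` is the
`n`-th derivative of a member of the Sobolev space. -/
theorem exists_memSobolevZero_of_orthogonal (hf1 : ∀ x, |f x| ≤ 1)
    (hm : Measurable f) (hS : S.Finite) (hfS : ∀ x ∉ S, ContinuousAt f x ∧ |f x| = 1) {n : ℕ}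
    (hn : 1 ≤ n)
    (horth : ∀ q : Polynomial ℝ, q.degree < n → ∫ t in (0 : ℝ)..1, f t * q.eval t = 0) :
    ∃ y, MemSobolevZero n ⊤ y ∧ segNorm ⊤ (segDeriv n y) = 1 ∧
      ∀ x ∈ Icc (0 : ℝ) 1, segDeriv (n - 1) y x = ∫ t in (0 : ℝ)..x, f t := by
  have hf : ∀ a b, IntervalIntegrable f volume a b := fun a b =>
    intervalIntegrable_const (c := (1 : ℝ)) |>.mono_fun hm.aestronglyMeasurable
      (Filter.Eventually.of_forall fun x => by simpa using hf1 x)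
  have hfS' : ∀ x ∉ S, ContinuousAt f x := fun x hx => (hfS x hx).1
  have hseg := fun i (hi : i < n) => segDeriv_iteratedPrimitive hf hm i hi
  have hae : segDeriv n (iteratedPrimitive f n) =ᵐ[volume.restrict (Icc (0 : ℝ) 1)] f := by
    refine (ae_restrict_iff' measurableSet_Icc).2 ?_
    filter_upwards [compl_mem_ae_iff.2 (hS.measure_zero volume)] with x hx hx'
    exact segDeriv_iteratedPrimitive_self hf hm hn hx' (hfS' x hx)
  refine ⟨iteratedPrimitive f n, ⟨?_, ?_, ?_, ?_, ?_⟩, ?_, ?_⟩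
  · intro j hj
    refine DifferentiableOn.congr (f := iteratedPrimitive f (n - j)) ?_ (hseg j (by omega))
    intro x _
    have e : n - j = (n - j - 1) + 1 := by omega
    rw [e]
    exact (hasDerivAt_iteratedPrimitive_succ hf hm _
      (Or.inl (by omega))).differentiableAt.differentiableWithinAt
  · intro j hj
    have e : n - j = (n - j - 1) + 1 := by omega
    have h1 := absolutelyContinuousOnInterval_iteratedPrimitive_succ hf (n - j - 1)
    rw [← e] at h1
    refine h1.congr_of_eqOn ?_
    rw [uIcc_of_le zero_le_one]
    exact hseg j hj
  · refine MemLp.ae_eq hae.symm ?_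
    exact memLp_top_of_bound hm.aestronglyMeasurable 1 (Filter.Eventually.of_forall hf1)
  · intro j hj
    rw [hseg j hj (by simp), show n - j = (n - j - 1) + 1 by omega, iteratedPrimitive_succ_zero]
  · intro j hj
    rw [hseg j hj (by simp), show n - j = (n - j - 1) + 1 by omega]
    exact iteratedPrimitive_one hf hm hS hfS' horth _ (by omega)
  · rw [segNorm, eLpNorm_congr_ae hae]
    have : ∀ᵐ x ∂(volume.restrict (Icc (0 : ℝ) 1)), ‖f x‖ = ‖(1 : ℝ)‖ := by
      refine ae_restrict_of_ae ?_
      filter_upwards [compl_mem_ae_iff.2 (hS.measure_zero volume)] with x hx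
      simpa using (hfS x hx).2
    rw [eLpNorm_congr_norm_ae this, eLpNorm_const _ (by simp)]
    · simp
    · simp
  · intro x hx
    rw [hseg (n - 1) (by omega) hx, show n - (n - 1) = 0 + 1 by omega]
    rfl
end

/-! ### Partial fractions, divided differences and the sign of the interpolation error -/

open Polynomial in
/-- Partial fractions: `∑ q(vᵢ) / W'(vᵢ) = 0` over the roots of `W` if `deg q ≤ deg W - 2`. -/
theorem sum_eval_div_derivative_eval_eq_zero {ι : Type*} [DecidableEq ι] {s : Finset ι}
    {v : ι → ℝ} (hv : Set.InjOn v s) {W q : ℝ[X]} (hW : W.natDegree = s.card)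
    (hroot : ∀ i ∈ s, W.eval (v i) = 0) (hq : q.natDegree + 1 < s.card) :
    ∑ i ∈ s, q.eval (v i) / W.derivative.eval (v i) = 0 := by
  have hW0 : W ≠ 0 := by
    rintro rfl
    simp only [natDegree_zero] at hW
    omega
  have hl : W.leadingCoeff ≠ 0 := leadingCoeff_ne_zero.2 hW0
  have hdeg : W.degree = s.card := by rw [degree_eq_natDegree hW0, hW]
  have e : W = C W.leadingCoeff * Lagrange.nodal s v := by
    refine eq_of_degree_le_of_eval_index_eq s hv hdeg.le ?_ ?_ ?_
    · rw [degree_C_mul hl, Lagrange.degree_nodal, hdeg]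
    · rw [leadingCoeff_mul, leadingCoeff_C, Lagrange.nodal_monic.leadingCoeff, mul_one]
    · intro i hi
      simp [hroot i hi, Lagrange.eval_nodal_at_node hi]
  -- The sum is, up to the leading coefficient of `W`, the top coefficient of the Lagrange
  -- interpolant of `q`, which vanishes because the degree of `q` is too small.
  have h1 := Lagrange.coeff_eq_sum hv (P := q) (degree_le_natDegree.trans_lt (by exact_mod_cast
    (by omega : q.natDegree < s.card)))
  rw [coeff_eq_zero_of_natDegree_lt (by omega)] at h1
  have h2 : ∀ i ∈ s, q.eval (v i) / W.derivative.eval (v i) =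
      (q.eval (v i) / ∏ j ∈ s.erase i, (v i - v j)) * W.leadingCoeff⁻¹ := by
    intro i hi
    conv_lhs => rw [e]
    rw [derivative_C_mul, eval_mul, eval_C, Lagrange.eval_nodal_derivative_eval_node_eq hi,
      Lagrange.eval_nodal]
    field_simp
  rw [Finset.sum_congr rfl h2, ← Finset.sum_mul, ← h1, zero_mul]

/-- The divided difference of `f` over the nodes `s`. -/
noncomputable def dividedDiff (f : ℝ → ℝ) (s : Finset ℝ) : ℝ :=
  ∑ x ∈ s, f x * ∏ y ∈ s.erase x, (x - y)⁻¹

theorem dividedDiff_erase (f : ℝ → ℝ) {s : Finset ℝ} {l : ℝ} (hl : l ∈ s) :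
    dividedDiff f (s.erase l) = ∑ x ∈ s, f x * (∏ y ∈ s.erase x, (x - y)⁻¹) * (x - l) := by
  rw [dividedDiff, ← Finset.add_sum_erase s _ hl, sub_self, mul_zero, zero_add]
  refine Finset.sum_congr rfl fun x hx => ?_
  have hxl := (Finset.mem_erase.1 hx).1
  rw [← Finset.mul_prod_erase (s.erase x) _ (Finset.mem_erase.2 ⟨hxl.symm, hl⟩),
    Finset.erase_right_comm]
  have : x - l ≠ 0 := sub_ne_zero.2 hxl
  field_simp

/-- The recurrence of divided differences, with any two nodes in the role of the extreme ones: both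
right-hand terms are the full sum with an extra factor `x - l` or `x - r`. -/
theorem sub_mul_dividedDiff (f : ℝ → ℝ) {s : Finset ℝ} {l r : ℝ} (hl : l ∈ s) (hr : r ∈ s) :
    (r - l) * dividedDiff f s = dividedDiff f (s.erase l) - dividedDiff f (s.erase r) := by
  rw [dividedDiff_erase f hl, dividedDiff_erase f hr, ← Finset.sum_sub_distrib, dividedDiff,
    Finset.mul_sum]
  exact Finset.sum_congr rfl fun x _ => by ring

theorem dividedDiff_eval_eq_zero {p : Polynomial ℝ} {s : Finset ℝ}
    (hp : p.natDegree + 1 < s.card) : dividedDiff (fun x => p.eval x) s = 0 := by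
  have h := Lagrange.coeff_eq_sum (v := id) (s := s) (Function.injective_id.injOn) (P := p)
    (Polynomial.degree_le_natDegree.trans_lt (by exact_mod_cast
    (by omega : p.natDegree < s.card)))
  rw [Polynomial.coeff_eq_zero_of_natDegree_lt (by omega)] at h
  rw [dividedDiff, h]
  refine Finset.sum_congr rfl fun x _ => ?_
  rw [Finset.prod_inv_distrib, div_eq_mul_inv]
  rfl

/-- The sign of a divided difference of a step function. -/
theorem dividedDiff_stepFn_sign (a : ℝ) (s : Finset ℝ) :
    0 ≤ (-1) ^ (s.filter (a < ·)).card * dividedDiff (stepFn a) s := by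
  induction hm : s.card generalizing s with
  | zero => simp [Finset.card_eq_zero.1 hm, dividedDiff]
  | succ m ih =>
    by_cases hL : ∃ l ∈ s, l ≤ a
    · by_cases hR : ∃ r ∈ s, a < r
      · obtain ⟨l, hl, hla⟩ := hL
        obtain ⟨r, hr, har⟩ := hR
        have h1 := ih (s.erase l) (by rw [Finset.card_erase_of_mem hl, hm]; rfl)
        have h2 := ih (s.erase r) (by rw [Finset.card_erase_of_mem hr, hm]; rfl)
        rw [Finset.filter_erase, Finset.erase_eq_of_notMem (by simp [hla])] at h1
        have hr' : r ∈ s.filter (a < ·) := by simp [hr, har]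
        rw [Finset.filter_erase] at h2
        have h3 := Finset.card_erase_add_one hr'
        rw [← h3, pow_succ] at h1 ⊢
        -- With `l ≤ a < r`, erasing `l` keeps the number of nodes beyond `a` and erasing `r` lowers
        -- it by one. The minus sign of the recurrence compensates, so both terms contribute with
        -- the same sign.
        have h4 := sub_mul_dividedDiff (stepFn a) hl hr
        have h5 : 0 < r - l := by linarith
        refine nonneg_of_mul_nonneg_right (b := _) (a := r - l) ?_ h5
        have : (r - l) * ((-1) ^ ((s.filter (a < ·)).erase r).card * -1 * dividedDiff (stepFn a) s)
            = (-1) ^ ((s.filter (a < ·)).erase r).card * -1 * dividedDiff (stepFn a) (s.erase l) +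
              (-1) ^ ((s.filter (a < ·)).erase r).card * dividedDiff (stepFn a) (s.erase r) := by
          linear_combination (-1) ^ ((s.filter (a < ·)).erase r).card * -1 * h4
        rw [this]
        exact add_nonneg h1 h2
      · have hR' : ∀ x ∈ s, x ≤ a := by
          intro x hx
          by_contra h
          exact hR ⟨x, hx, not_le.1 h⟩
        have h0 : s.filter (a < ·) = ∅ := by
          rw [Finset.filter_eq_empty_iff]
          intro x hx
          exact not_lt.2 (hR' x hx)
        rw [h0, Finset.card_empty, pow_zero, one_mul]
        have h1 : dividedDiff (stepFn a) s = dividedDiff (fun x => (1 : Polynomial ℝ).eval x) s := by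
          refine Finset.sum_congr rfl fun x hx => ?_
          simp only [stepFn_of_le (hR' x hx), Polynomial.eval_one]
        rw [h1]
        rcases Nat.eq_zero_or_pos m with h | h
        · obtain ⟨x, rfl⟩ := Finset.card_eq_one.1 (by omega : s.card = 1)
          simp [dividedDiff]
        · rw [dividedDiff_eval_eq_zero]
          rw [Polynomial.natDegree_one]
          omega
    · have : dividedDiff (stepFn a) s = 0 := by
        refine Finset.sum_eq_zero fun x hx => ?_
        rw [stepFn_of_lt, zero_mul]
        by_contra h
        exact hL ⟨x, hx, not_lt.1 h⟩
      simp [this]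

/-- The sign of the error in interpolating a step function. -/
theorem stepFn_sub_eval_mul_nonneg {a : ℝ} {t : Finset ℝ} {p : Polynomial ℝ}
    (hp : p.natDegree < t.card) (hpt : ∀ y ∈ t, p.eval y = stepFn a y) (x : ℝ) :
    0 ≤ (stepFn a x - p.eval x) *
      ((-1) ^ (t.filter (a < ·)).card * ((a - x) * ∏ y ∈ t, (x - y))) := by
  by_cases hx : x ∈ t
  · rw [hpt x hx, sub_self, zero_mul]
  have h1 := dividedDiff_eval_eq_zero (p := p) (s := insert x t) (by
    rw [Finset.card_insert_of_notMem hx]; omega)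
  -- The divided difference over `t ∪ {x}` annihilates `p`, and the step function minus `p` vanishes
  -- on `t`, so only the term at `x` survives.
  have h2 : dividedDiff (stepFn a) (insert x t) =
      (stepFn a x - p.eval x) * ∏ y ∈ t, (x - y)⁻¹ := by
    rw [← sub_zero (dividedDiff _ _), ← h1, dividedDiff, dividedDiff, ← Finset.sum_sub_distrib,
      Finset.sum_insert hx, Finset.erase_insert hx, Finset.sum_eq_zero fun y hy => ?_, add_zero]
    · ring
    · rw [hpt y hy, sub_self]
  have h3 := dividedDiff_stepFn_sign a (insert x t)
  rw [h2, Finset.prod_inv_distrib] at h3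
  have h4 := mul_nonneg h3 (sq_nonneg (∏ y ∈ t, (x - y)))
  have hne : ∏ y ∈ t, (x - y) ≠ 0 := by
    rw [Finset.prod_ne_zero_iff]
    intro y hy h
    exact hx (sub_eq_zero.1 h ▸ hy)
  rw [Finset.filter_insert] at h4
  have h5 : ∀ z : ℝ, z * ((stepFn a x - p.eval x) * (∏ y ∈ t, (x - y))⁻¹) *
      (∏ y ∈ t, (x - y)) ^ 2 = z * (stepFn a x - p.eval x) * ∏ y ∈ t, (x - y) := by
    intro z
    field_simp
  rw [h5] at h4
  -- If `x` lies beyond `a` it is itself counted in the exponent; the factor `a - x` changes sign at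
  -- the same place and absorbs this.
  rcases le_or_gt x a with h | h
  · rw [if_neg (not_lt.2 h)] at h4
    have := mul_nonneg (sub_nonneg.2 h) h4
    calc (0 : ℝ) ≤ _ := this
      _ = _ := by ring
  · rw [if_pos h, Finset.card_insert_of_notMem (by simp [hx]), pow_succ] at h4
    have := mul_nonneg (sub_nonneg.2 h.le) h4
    calc (0 : ℝ) ≤ _ := this
      _ = _ := by ring

/-! ### Sign functions of polynomials as extremal `n`-th derivatives -/

/-- The sign of a polynomial, as a function. -/
noncomputable def signFn (N : Polynomial ℝ) (x : ℝ) : ℝ := Real.sign (N.eval x)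

theorem Real.abs_sign_le_one (x : ℝ) : |Real.sign x| ≤ 1 := by
  rcases Real.sign_apply_eq x with h | h | h <;> simp [h]

theorem measurable_signFn (N : Polynomial ℝ) : Measurable (signFn N) := by
  have : Measurable Real.sign := by
    unfold Real.sign
    exact Measurable.ite measurableSet_Iio measurable_const
      (Measurable.ite measurableSet_Ioi measurable_const measurable_const)
  exact this.comp N.continuous.measurable

theorem intervalIntegrable_signFn (N : Polynomial ℝ) (a b : ℝ) :
    IntervalIntegrable (signFn N) volume a b :=
  intervalIntegrable_const (c := (1 : ℝ)) |>.mono_fun (measurable_signFn N).aestronglyMeasurable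
    (Filter.Eventually.of_forall fun x => by
      simp only [Real.norm_eq_abs, abs_one]
      exact Real.abs_sign_le_one (N.eval x))

theorem abs_signFn {N : Polynomial ℝ} {x : ℝ} (hx : N.eval x ≠ 0) : |signFn N x| = 1 := by
  rcases lt_or_gt_of_ne hx with h | h
  · simp [signFn, Real.sign_of_neg h]
  · simp [signFn, Real.sign_of_pos h]

theorem continuousAt_signFn {N : Polynomial ℝ} {x : ℝ} (hx : N.eval x ≠ 0) :
    ContinuousAt (signFn N) x := by
  rcases lt_or_gt_of_ne hx with h | h
  · have : signFn N =ᶠ[nhds x] fun _ => -1 := by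
      filter_upwards [N.continuous.continuousAt.eventually_lt continuousAt_const h] with y hy
      exact Real.sign_of_neg hy
    exact this.continuousAt
  · have : signFn N =ᶠ[nhds x] fun _ => 1 := by
      filter_upwards [continuousAt_const.eventually_lt N.continuous.continuousAt h] with y hy
      exact Real.sign_of_pos hy
    exact this.continuousAt

/-- A sign function orthogonal to the polynomials of degree less than `n` is an `n`-th derivative
of a function in the Sobolev space. -/
theorem exists_memSobolevZero_of_signFn {N : Polynomial ℝ} (hN : N ≠ 0) {n : ℕ} (hn : 1 ≤ n)
    (horth : ∀ q : Polynomial ℝ, q.degree < n → ∫ t in (0 : ℝ)..1, signFn N t * q.eval t = 0) :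
    ∃ y, MemSobolevZero n ⊤ y ∧ segNorm ⊤ (segDeriv n y) = 1 ∧
      ∀ x ∈ Icc (0 : ℝ) 1, segDeriv (n - 1) y x = ∫ t in (0 : ℝ)..x, signFn N t := by
  refine exists_memSobolevZero_of_orthogonal (S := {x | N.eval x = 0})
    (fun x => Real.abs_sign_le_one _) (measurable_signFn N) ?_ ?_ hn horth
  · exact Polynomial.finite_setOfPred_isRoot hN
  · intro x hx
    exact ⟨continuousAt_signFn hx, abs_signFn hx⟩

/-- The lower half of the duality: the extremal function built from the sign function has `n`-th
derivative of norm one. -/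
theorem ofReal_abs_integral_signFn_le_pointConst {N : Polynomial ℝ} (hN : N ≠ 0) {n : ℕ}
    (hn : 1 ≤ n)
    (horth : ∀ q : Polynomial ℝ, q.degree < n → ∫ t in (0 : ℝ)..1, signFn N t * q.eval t = 0)
    {a : ℝ} (ha : a ∈ Icc (0 : ℝ) 1) :
    ENNReal.ofReal |∫ t in (0 : ℝ)..a, signFn N t| ≤ pointConst n (n - 1) ⊤ a := by
  obtain ⟨y, hy, h1, h2⟩ := exists_memSobolevZero_of_signFn hN hn horth
  rw [← h2 a ha]
  exact le_pointConst_of_memSobolevZero hy h1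

/-- If the error of approximation of the step function by `p` has the sign of `ε N`, then the
error is given by an integral of the sign of `N`. -/
theorem integral_abs_stepFn_sub_eval {N : Polynomial ℝ} (hN : N ≠ 0) {n : ℕ}
    (horth : ∀ q : Polynomial ℝ, q.degree < n → ∫ t in (0 : ℝ)..1, signFn N t * q.eval t = 0)
    {a : ℝ} (ha : a ∈ Icc (0 : ℝ) 1) {p : Polynomial ℝ} (hp : p.degree < n) {ε : ℝ}
    (hε : ε = 1 ∨ ε = -1)
    (hs : ∀ x ∈ Ioo (0 : ℝ) 1, 0 ≤ (stepFn a x - p.eval x) * (ε * N.eval x)) :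
    ∫ t in (0 : ℝ)..1, |stepFn a t - p.eval t| = ε * ∫ t in (0 : ℝ)..a, signFn N t := by
  have h1 := integral_mul_stepFn (intervalIntegrable_signFn N 0 1) ha
  -- Off the finitely many roots of `N`, the absolute value of the error is `ε` times the sign of
  -- `N` times the error; orthogonality then removes `p`.
  have h2 : ∫ t in (0 : ℝ)..1, |stepFn a t - p.eval t| =
      ∫ t in (0 : ℝ)..1, ε * (signFn N t * stepFn a t - signFn N t * p.eval t) := by
    refine intervalIntegral.integral_congr_ae ?_
    filter_upwards [compl_mem_ae_iff.2 ((Polynomial.finite_setOfPred_isRoot hN).measure_zero volume),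
      ae_mem_uIoc_imp_of_Ioo zero_le_one hs] with x hx hx1 hx2
    have h3 := hx1 hx2
    have hx : N.eval x ≠ 0 := hx
    rcases lt_or_gt_of_ne hx with h | h
    · rw [signFn, Real.sign_of_neg h]
      rcases hε with rfl | rfl
      · rw [abs_of_nonpos (by nlinarith)]; ring
      · rw [abs_of_nonneg (by nlinarith)]; ring
    · rw [signFn, Real.sign_of_pos h]
      rcases hε with rfl | rfl
      · rw [abs_of_nonneg (by nlinarith)]; ring
      · rw [abs_of_nonpos (by nlinarith)]; ring
  rw [h2, intervalIntegral.integral_const_mul, intervalIntegral.integral_sub h1.1, h1.2,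
    horth p hp, sub_zero]
  exact (intervalIntegrable_signFn N 0 1).mul_continuousOn p.continuous.continuousOn

/-! ### Alternating nodes and the orthogonality they encode -/

/-- Nodes `0 = x₀ < x₁ < ⋯ < xₘ < xₘ₊₁ = 1` for which the function with alternating values `±1` on
the successive intervals is orthogonal to the polynomials of degree less than `n`. -/
structure AlternatingNodes (n m : ℕ) (x : ℕ → ℝ) : Prop where
  zero : x 0 = 0
  one : x (m + 1) = 1
  lt_succ : ∀ i ≤ m, x i < x (i + 1)
  sum_eq : ∀ Q : Polynomial ℝ, Q.natDegree ≤ n →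
    Q.eval 0 + 2 * ∑ i ∈ Finset.Icc 1 m, (-1) ^ i * Q.eval (x i) + (-1) ^ (m + 1) * Q.eval 1 = 0

/-- The polynomial `∏ (xᵢ - X)`, `1 ≤ i ≤ m`. -/
noncomputable def nodePoly (m : ℕ) (x : ℕ → ℝ) : Polynomial ℝ :=
  ∏ i ∈ Finset.Icc 1 m, (Polynomial.C (x i) - Polynomial.X)

theorem eval_nodePoly (m : ℕ) (x : ℕ → ℝ) (t : ℝ) :
    (nodePoly m x).eval t = ∏ i ∈ Finset.Icc 1 m, (x i - t) := by
  simp [nodePoly, Polynomial.eval_prod]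

theorem nodePoly_ne_zero (m : ℕ) (x : ℕ → ℝ) : nodePoly m x ≠ 0 := by
  rw [nodePoly, Finset.prod_ne_zero_iff]
  intro i _ h
  rw [← neg_sub, neg_eq_zero] at h
  exact Polynomial.X_sub_C_ne_zero _ h

/-- Summation by parts: interior values occur in two neighbouring differences with opposite
orientation, hence the weight `2`, and the end values only once. -/
theorem sum_range_neg_one_pow_mul_sub (b : ℕ → ℝ) (k : ℕ) :
    ∑ i ∈ Finset.range (k + 1), (-1) ^ i * (b (i + 1) - b i) =
      -(b 0 + 2 * ∑ i ∈ Finset.Ico 1 (k + 1), (-1) ^ i * b i + (-1) ^ (k + 1) * b (k + 1)) := by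
  induction k with
  | zero => simp; ring
  | succ k ih =>
    rw [Finset.sum_range_succ, ih, Finset.sum_Ico_succ_top (show 1 ≤ k + 1 by omega)]
    ring

namespace AlternatingNodes
variable {n m : ℕ} {x : ℕ → ℝ}

theorem lt (h : AlternatingNodes n m x) {i j : ℕ} (hij : i < j) (hj : j ≤ m + 1) :
    x i < x j := by
  induction j with
  | zero => omega
  | succ j ih =>
    rcases Nat.lt_succ_iff_lt_or_eq.1 hij with h' | h'
    · exact (ih h' (by omega)).trans (h.lt_succ j (by omega))
    · subst h'
      exact h.lt_succ i (by omega)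

theorem le (h : AlternatingNodes n m x) {i j : ℕ} (hij : i ≤ j) (hj : j ≤ m + 1) :
    x i ≤ x j := by
  rcases hij.lt_or_eq with h' | h'
  · exact (h.lt h' hj).le
  · rw [h']

theorem mem_Icc (h : AlternatingNodes n m x) {i : ℕ} (hi : i ≤ m + 1) :
    x i ∈ Icc (0 : ℝ) 1 :=
  ⟨h.zero ▸ h.le (Nat.zero_le i) hi, h.one ▸ h.le hi le_rfl⟩

theorem mem_Ioo (h : AlternatingNodes n m x) {i : ℕ} (hi : 1 ≤ i) (hi' : i ≤ m) :
    x i ∈ Ioo (0 : ℝ) 1 :=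
  ⟨h.zero ▸ h.lt hi (by omega), h.one ▸ h.lt (Nat.lt_succ_of_le hi') le_rfl⟩

theorem injOn (h : AlternatingNodes n m x) : Set.InjOn x (Set.Iic (m + 1)) := by
  intro i hi j hj hij
  rcases lt_trichotomy i j with h' | h' | h'
  · exact absurd hij (h.lt h' hj).ne
  · exact h'
  · exact absurd hij (h.lt h' hi).ne'

theorem nodePoly_sign (h : AlternatingNodes n m x) {j : ℕ} (hj : j ≤ m) {t : ℝ}
    (ht : t ∈ Ioo (x j) (x (j + 1))) : 0 < (-1) ^ j * (nodePoly m x).eval t := by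
  have e : Finset.Icc 1 m = Finset.Icc 1 j ∪ Finset.Icc (j + 1) m := by
    ext i; simp only [Finset.mem_Icc, Finset.mem_union]; omega
  have hd : Disjoint (Finset.Icc 1 j) (Finset.Icc (j + 1) m) := by
    rw [Finset.disjoint_left]; intro i; simp only [Finset.mem_Icc]; omega
  have hc : ((-1 : ℝ)) ^ j = ∏ i ∈ Finset.Icc 1 j, (-1 : ℝ) := by simp
  rw [eval_nodePoly, e, Finset.prod_union hd, ← mul_assoc, hc, ← Finset.prod_mul_distrib]
  refine mul_pos (Finset.prod_pos fun i hi => ?_) (Finset.prod_pos fun i hi => ?_)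
  · have := h.le (Finset.mem_Icc.1 hi).2 (by omega)
    linarith [ht.1]
  · have hi' := Finset.mem_Icc.1 hi
    have := h.le hi'.1 (by omega)
    linarith [ht.2]

theorem signFn_eq (h : AlternatingNodes n m x) {j : ℕ} (hj : j ≤ m) {t : ℝ}
    (ht : t ∈ Ioo (x j) (x (j + 1))) : signFn (nodePoly m x) t = (-1) ^ j := by
  have := h.nodePoly_sign hj ht
  rcases neg_one_pow_eq_or ℝ j with e | e
  · rw [e] at this ⊢
    exact Real.sign_of_pos (by linarith)
  · rw [e] at this ⊢
    exact Real.sign_of_neg (by linarith)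

theorem integral_signFn_mul_derivative (h : AlternatingNodes n m x) (Q : Polynomial ℝ) {k : ℕ}
    (hk : k ≤ m + 1) :
    ∫ t in (0 : ℝ)..x k, signFn (nodePoly m x) t * Q.derivative.eval t =
      ∑ i ∈ Finset.range k, (-1) ^ i * (Q.eval (x (i + 1)) - Q.eval (x i)) := by
  have hi : ∀ a b, IntervalIntegrable
      (fun t => signFn (nodePoly m x) t * Q.derivative.eval t) volume a b := fun a b =>
    (intervalIntegrable_signFn _ a b).mul_continuousOn Q.derivative.continuous.continuousOn
  rw [← h.zero, ← intervalIntegral.sum_integral_adjacent_intervals fun i _ => hi _ _]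
  refine Finset.sum_congr rfl fun i hi' => ?_
  have hik := Finset.mem_range.1 hi'
  have hlt := h.lt_succ i (by omega)
  have : ∫ t in x i..x (i + 1), signFn (nodePoly m x) t * Q.derivative.eval t =
      ∫ t in x i..x (i + 1), (-1) ^ i * Q.derivative.eval t := by
    refine intervalIntegral.integral_congr_ae (ae_mem_uIoc_imp_of_Ioo hlt.le fun t ht => ?_)
    rw [h.signFn_eq (by omega) ht]
  rw [this, intervalIntegral.integral_const_mul,
    intervalIntegral.integral_eq_sub_of_hasDerivAt (fun t _ => Q.hasDerivAt t)
      (Q.derivative.continuous.intervalIntegrable _ _)]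

/-- Integrating `Q'` against the alternating signs gives minus the left side of `sum_eq`, so the
quadrature identity for degrees up to `n` is orthogonality for degrees below `n`. -/
theorem orthogonal (h : AlternatingNodes n m x) (q : Polynomial ℝ) (hq : q.degree < n) :
    ∫ t in (0 : ℝ)..1, signFn (nodePoly m x) t * q.eval t = 0 := by
  obtain ⟨Q, rfl, hQ, -⟩ := q.exists_derivative_eq hq
  have h1 := h.integral_signFn_mul_derivative Q le_rfl
  have h2 := h.sum_eq Q (by
    by_cases h0 : Q = 0
    · simp [h0]
    · exact Nat.lt_succ_iff.1 ((Polynomial.natDegree_lt_iff_degree_lt h0).2 hQ))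
  rw [sum_range_neg_one_pow_mul_sub (fun i => Q.eval (x i)), h.zero, h.one] at h1
  rw [h1]
  have e : Finset.Ico 1 (m + 1) = Finset.Icc 1 m := rfl
  rw [e, h2, neg_zero]

theorem integral_signFn (h : AlternatingNodes n m x) {k : ℕ} (hk1 : 1 ≤ k) (hk : k ≤ m + 1) :
    ∫ t in (0 : ℝ)..x k, signFn (nodePoly m x) t =
      -(2 * ∑ i ∈ Finset.Ico 1 k, (-1) ^ i * x i + (-1) ^ k * x k) := by
  have h1 := h.integral_signFn_mul_derivative Polynomial.X hk
  obtain ⟨k, rfl⟩ : ∃ j, k = j + 1 := ⟨k - 1, by omega⟩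
  simp only [Polynomial.derivative_X, Polynomial.eval_one, mul_one, Polynomial.eval_X] at h1
  rw [h1, sum_range_neg_one_pow_mul_sub, h.zero]
  ring

theorem le_pointConst (h : AlternatingNodes n m x) (hn : 1 ≤ n) {k : ℕ} (hk1 : 1 ≤ k)
    (hk : k ≤ m + 1) :
    ENNReal.ofReal |2 * ∑ i ∈ Finset.Ico 1 k, (-1) ^ i * x i + (-1) ^ k * x k| ≤
      pointConst n (n - 1) ⊤ (x k) := by
  have := ofReal_abs_integral_signFn_le_pointConst (nodePoly_ne_zero m x) hn h.orthogonal
    (h.mem_Icc hk)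
  rwa [h.integral_signFn hk1 hk, abs_neg] at this

/-- Interpolating the step function at `x k` at the other nodes, and at further nodes if need be,
with the right sign of the error. -/
theorem integral_abs_stepFn_sub (h : AlternatingNodes n m x) {k : ℕ} (hk1 : 1 ≤ k)
    (hk : k ≤ m + 1) {p : Polynomial ℝ} (hp : p.degree < n)
    (hs : ∀ t ∈ Ioo (0 : ℝ) 1,
      0 ≤ (stepFn (x k) t - p.eval t) * ((-1) ^ (k + 1) * (nodePoly m x).eval t)) :
    ∫ t in (0 : ℝ)..1, |stepFn (x k) t - p.eval t| =
      (-1) ^ k * (2 * ∑ i ∈ Finset.Ico 1 k, (-1) ^ i * x i + (-1) ^ k * x k) := by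
  rw [integral_abs_stepFn_sub_eval (nodePoly_ne_zero m x) h.orthogonal (h.mem_Icc hk) hp
    (neg_one_pow_eq_or ℝ (k + 1)) hs, h.integral_signFn hk1 hk]
  ring

end AlternatingNodes

/-! ### Quadrature identities from a polynomial with prescribed derivatives at its roots -/

open Polynomial in
/-- Nodes `0 = x₀ < x₁ < ⋯ < xₘ < xₘ₊₁ = 1` where `x₁, …, xₘ` are the roots of a polynomial `W`
of degree `m` whose derivatives at these roots are `(-1)ⁱ l(xᵢ) / (2 xᵢ (1 - xᵢ))`. -/
structure WeightedNodes (m : ℕ) (x : ℕ → ℝ) (W l : ℝ[X]) : Prop where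
  zero : x 0 = 0
  one : x (m + 1) = 1
  lt_succ : ∀ i ≤ m, x i < x (i + 1)
  natDegree : W.natDegree = m
  root : ∀ i, 1 ≤ i → i ≤ m → W.eval (x i) = 0
  derivative_eval : ∀ i, 1 ≤ i → i ≤ m →
    2 * x i * (1 - x i) * W.derivative.eval (x i) = (-1) ^ i * l.eval (x i)
  eval_at_zero : W.eval 0 = l.eval 0
  eval_at_one : W.eval 1 = (-1) ^ m * l.eval 1
  weight_pos : ∀ t ∈ Icc (0 : ℝ) 1, 0 < l.eval t

namespace WeightedNodes
open Polynomial
variable {m : ℕ} {x : ℕ → ℝ} {W l : ℝ[X]}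

theorem lt (h : WeightedNodes m x W l) {i j : ℕ} (hij : i < j) (hj : j ≤ m + 1) :
    x i < x j := by
  induction j with
  | zero => omega
  | succ j ih =>
    rcases Nat.lt_succ_iff_lt_or_eq.1 hij with h' | h'
    · exact (ih h' (by omega)).trans (h.lt_succ j (by omega))
    · subst h'
      exact h.lt_succ i (by omega)

theorem injOn (h : WeightedNodes m x W l) : Set.InjOn x (Set.Iic (m + 1)) := by
  intro i hi j hj hij
  rcases lt_trichotomy i j with h' | h' | h'
  · exact absurd hij (h.lt h' hj).ne
  · exact h'
  · exact absurd hij (h.lt h' hi).ne'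

theorem pos (h : WeightedNodes m x W l) {i : ℕ} (hi : 1 ≤ i) (hi' : i ≤ m) : 0 < x i :=
  h.zero ▸ h.lt hi (by omega)

theorem lt_one (h : WeightedNodes m x W l) {i : ℕ} (hi' : i ≤ m) : x i < 1 :=
  h.one ▸ h.lt (Nat.lt_succ_of_le hi') le_rfl

theorem weight_pos_node (h : WeightedNodes m x W l) {i : ℕ} (hi : 1 ≤ i) (hi' : i ≤ m) :
    0 < l.eval (x i) :=
  h.weight_pos _ ⟨(h.pos hi hi').le, (h.lt_one hi').le⟩

theorem ne_zero (h : WeightedNodes m x W l) : W ≠ 0 := by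
  intro h0
  have := h.eval_at_zero
  rw [h0, eval_zero] at this
  exact (h.weight_pos 0 (by simp)).ne this

/-- Partial fractions for `q / W`, the condition on `W'` giving `1 / W'(xᵢ) = 2 (-1)ⁱ xᵢ (1 - xᵢ) /
l(xᵢ)`. The end points do not enter, at the price of the weight. -/
theorem sum_Icc_eval_div (h : WeightedNodes m x W l) (q : ℝ[X]) (hq : q.natDegree + 1 < m) :
    ∑ i ∈ Finset.Icc 1 m, (-1) ^ i * q.eval (x i) * (x i * (1 - x i) / l.eval (x i)) = 0 := by
  have h1 := sum_eval_div_derivative_eval_eq_zero (s := Finset.Icc 1 m) (v := x) (W := W) (q := q)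
    (h.injOn.mono fun i hi => by
      have := (Finset.mem_Icc.1 hi).2
      exact Set.mem_Iic.2 (by omega))
    (by rw [h.natDegree, Nat.card_Icc]; omega)
    (fun i hi => h.root i (Finset.mem_Icc.1 hi).1 (Finset.mem_Icc.1 hi).2)
    (by rw [Nat.card_Icc]; omega)
  have h2 : ∑ i ∈ Finset.Icc 1 m, (-1) ^ i * q.eval (x i) * (x i * (1 - x i) / l.eval (x i)) =
      ∑ i ∈ Finset.Icc 1 m, (q.eval (x i) / W.derivative.eval (x i)) * (1 / 2) := by
    refine Finset.sum_congr rfl fun i hi => ?_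
    obtain ⟨hi, hi'⟩ := Finset.mem_Icc.1 hi
    have hl := h.weight_pos_node hi hi'
    have hd := h.derivative_eval i hi hi'
    have hs : ((-1 : ℝ) ^ i) ^ 2 = 1 := by rw [← pow_mul, mul_comm, pow_mul]; simp
    have hW : W.derivative.eval (x i) ≠ 0 := by
      intro h0
      rw [h0, mul_zero] at hd
      have : (-1 : ℝ) ^ i ≠ 0 := by simp
      exact (mul_ne_zero this hl.ne') hd.symm
    rw [mul_div_assoc', div_mul_eq_mul_div, div_eq_div_iff hl.ne' hW]
    linear_combination (1 / 2) * (-1) ^ i * q.eval (x i) * hd +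
      (1 / 2) * q.eval (x i) * l.eval (x i) * hs
  rw [h2, ← Finset.sum_mul, h1, zero_mul]

/-- The nodes together with the end point `1`. -/
theorem sum_Icc_eval_div_of_eval_one (h : WeightedNodes m x W l) (p : ℝ[X])
    (hp : p.natDegree < m) (hp1 : p.eval 1 = 0) :
    ∑ i ∈ Finset.Icc 1 m, (-1) ^ i * p.eval (x i) * (x i / l.eval (x i)) = 0 := by
  obtain ⟨q, rfl⟩ := dvd_iff_isRoot.2 hp1
  by_cases h0 : q = 0
  · simp [h0]
  have hd : q.natDegree + 1 < m := by
    rw [natDegree_mul (X_sub_C_ne_zero _) h0, natDegree_X_sub_C] at hp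
    omega
  have h1 := h.sum_Icc_eval_div q hd
  rw [← neg_eq_zero, ← Finset.sum_neg_distrib] at h1
  rw [← h1]
  refine Finset.sum_congr rfl fun i _ => ?_
  simp only [eval_mul, eval_sub, eval_X, eval_C]
  ring

/-- The nodes together with the end point `0`. -/
theorem sum_Icc_eval_div_of_eval_zero (h : WeightedNodes m x W l) (p : ℝ[X])
    (hp : p.natDegree < m) (hp1 : p.eval 0 = 0) :
    ∑ i ∈ Finset.Icc 1 m, (-1) ^ i * p.eval (x i) * ((1 - x i) / l.eval (x i)) = 0 := by
  obtain ⟨q, rfl⟩ := dvd_iff_isRoot.2 hp1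
  by_cases h0 : q = 0
  · simp [h0]
  have hd : q.natDegree + 1 < m := by
    rw [natDegree_mul (X_sub_C_ne_zero _) h0, natDegree_X_sub_C] at hp
    omega
  refine Eq.trans (Finset.sum_congr rfl fun i _ => ?_) (h.sum_Icc_eval_div q hd)
  simp only [eval_mul, eval_sub, eval_X, eval_C]
  ring

/-- Partial fractions for `Q l / (X (1 - X) W)`. At an interior root the derivative of the
denominator is `(-1)ⁱ l(xᵢ) / 2`, so `l` cancels and the residue is `2 (-1)ⁱ Q(xᵢ)`. At the end
points the conditions on `W` itself give residues of half this size. -/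
theorem sum_eq (h : WeightedNodes m x W l) (Q : ℝ[X])
    (hQ : Q.natDegree + l.natDegree ≤ m) :
    Q.eval 0 + 2 * ∑ i ∈ Finset.Icc 1 m, (-1) ^ i * Q.eval (x i) + (-1) ^ (m + 1) * Q.eval 1 =
      0 := by
  have hE : (X * (1 - X) : ℝ[X]) = X - X ^ 2 := by ring
  have hdE : (X * (1 - X) : ℝ[X]).natDegree = 2 := by
    rw [hE]; compute_degree!
  have hE0 : (X * (1 - X) : ℝ[X]) ≠ 0 := by
    intro h0; rw [h0] at hdE; simp at hdE
  have h1 := sum_eval_div_derivative_eval_eq_zero (s := Finset.range (m + 2)) (v := x)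
    (W := X * (1 - X) * W) (q := Q * l)
    (h.injOn.mono fun i hi => by
      have := Finset.mem_range.1 hi
      exact Set.mem_Iic.2 (by omega))
    (by rw [natDegree_mul hE0 h.ne_zero, h.natDegree, hdE, Finset.card_range, add_comm])
    (fun i hi => by
      rcases Nat.eq_zero_or_pos i with hi0 | hi0
      · simp [hi0, h.zero]
      · rcases (by have := Finset.mem_range.1 hi; omega : i ≤ m ∨ i = m + 1) with hi1 | hi1
        · simp [h.root i hi0 hi1]
        · simp [hi1, h.one])
    (by
      rw [Finset.card_range]
      have := natDegree_mul_le (p := Q) (q := l)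
      omega)
  have hder : ∀ t, (derivative (X * (1 - X) * W)).eval t =
      (1 - 2 * t) * W.eval t + t * (1 - t) * W.derivative.eval t := by
    intro t
    simp only [derivative_mul, derivative_X, derivative_sub, derivative_one, eval_add, eval_mul,
      eval_sub, eval_X, eval_one, eval_zero]
    ring
  have e : Finset.Ico 1 (m + 1) = Finset.Icc 1 m := rfl
  have hl1 := (h.weight_pos 1 (by simp)).ne'
  have hl0 := h.weight_pos 0 (by simp)
  have hs : ((-1 : ℝ) ^ m) ^ 2 = 1 := by rw [← pow_mul, mul_comm, pow_mul]; simp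
  have hmid : ∀ i ∈ Finset.Icc 1 m, (Q * l).eval (x i) /
      (derivative (X * (1 - X) * W)).eval (x i) = 2 * ((-1) ^ i * Q.eval (x i)) := by
    intro i hi
    obtain ⟨hi, hi'⟩ := Finset.mem_Icc.1 hi
    have hl := h.weight_pos_node hi hi'
    have hd := h.derivative_eval i hi hi'
    have hs : ((-1 : ℝ) ^ i) ^ 2 = 1 := by rw [← pow_mul, mul_comm, pow_mul]; simp
    have hW : (x i * (1 - x i)) * W.derivative.eval (x i) ≠ 0 := by
      intro h0
      have h2 : (-1 : ℝ) ^ i * l.eval (x i) = 0 := by rw [← hd]; linear_combination 2 * h0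
      have : (-1 : ℝ) ^ i ≠ 0 := by simp
      exact (mul_ne_zero this hl.ne') h2
    rw [hder, h.root i hi hi', mul_zero, zero_add, eval_mul, div_eq_iff hW]
    linear_combination -Q.eval (x i) * (-1) ^ i * hd - Q.eval (x i) * l.eval (x i) * hs
  rw [Finset.sum_range_succ, Finset.range_eq_Ico, Finset.sum_eq_sum_Ico_succ_bot (by omega), e,
    Finset.sum_congr rfl hmid, hder, hder, h.one, h.zero, h.eval_at_zero, h.eval_at_one,
    ← Finset.mul_sum, eval_mul, eval_mul] at h1
  have e0 : Q.eval 0 * l.eval 0 / ((1 - 2 * 0) * l.eval 0 + 0 * (1 - 0) * W.derivative.eval 0) =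
      Q.eval 0 := by
    have : (1 - 2 * 0) * l.eval 0 + 0 * (1 - 0) * W.derivative.eval 0 = l.eval 0 := by ring
    rw [this, mul_div_cancel_right₀ _ hl0.ne']
  have e1 : Q.eval 1 * l.eval 1 / ((1 - 2 * 1) * ((-1) ^ m * l.eval 1) +
      1 * (1 - 1) * W.derivative.eval 1) = (-1) ^ (m + 1) * Q.eval 1 := by
    have h3 : (-1 : ℝ) ^ m ≠ 0 := by simp
    have : (1 - 2 * 1) * ((-1) ^ m * l.eval 1) + 1 * (1 - 1) * W.derivative.eval 1 =
      -((-1) ^ m * l.eval 1) := by ring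
    rw [this, div_eq_iff (neg_ne_zero.2 (mul_ne_zero h3 hl1))]
    linear_combination -Q.eval 1 * l.eval 1 * hs
  rw [e0, e1] at h1
  exact h1

theorem alternatingNodes (h : WeightedNodes m x W l) {n : ℕ}
    (hn : n + l.natDegree ≤ m) : AlternatingNodes n m x :=
  ⟨h.zero, h.one, h.lt_succ, fun Q hQ => h.sum_eq Q (by omega)⟩

end WeightedNodes

/-! ### Chebyshev nodes and the one-parameter family of nodes -/

open Polynomial in
/-- The Chebyshev polynomial of the second kind transported to `[0, 1]`. -/
noncomputable def shiftedU (n : ℕ) : ℝ[X] := (Chebyshev.U ℝ n).comp (1 - 2 * X)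

open Polynomial in
/-- The Chebyshev polynomial of the first kind transported to `[0, 1]`. -/
noncomputable def shiftedT (n : ℕ) : ℝ[X] := (Chebyshev.T ℝ n).comp (1 - 2 * X)

section
open Polynomial

theorem one_sub_two_mul_X_eq : (1 - 2 * X : ℝ[X]) = C (-2) * X + C 1 := by
  simp only [C_neg, map_ofNat, map_one]
  ring

theorem natDegree_one_sub_two_mul_X : (1 - 2 * X : ℝ[X]).natDegree = 1 := by
  rw [one_sub_two_mul_X_eq, natDegree_linear (by norm_num)]

theorem leadingCoeff_one_sub_two_mul_X : (1 - 2 * X : ℝ[X]).leadingCoeff = -2 := by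
  rw [one_sub_two_mul_X_eq, leadingCoeff_linear (by norm_num)]

theorem natDegree_shiftedU (n : ℕ) : (shiftedU n).natDegree = n := by
  rw [shiftedU, natDegree_comp, natDegree_one_sub_two_mul_X, mul_one,
    Chebyshev.natDegree_U_natCast]

theorem natDegree_shiftedT (n : ℕ) : (shiftedT n).natDegree = n := by
  rw [shiftedT, natDegree_comp, natDegree_one_sub_two_mul_X, mul_one, Chebyshev.natDegree_T,
    Int.natAbs_natCast]

theorem coeff_shiftedU (n : ℕ) : (shiftedU n).coeff n = 2 ^ n * (-2) ^ n := by
  have h : (shiftedU n).leadingCoeff = 2 ^ n * (-2) ^ n := by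
    rw [shiftedU, leadingCoeff_comp (by rw [natDegree_one_sub_two_mul_X]; exact one_ne_zero),
      leadingCoeff_one_sub_two_mul_X, Chebyshev.natDegree_U_natCast,
      Chebyshev.leadingCoeff_U_natCast]
  rwa [leadingCoeff, natDegree_shiftedU] at h

theorem coeff_shiftedT_succ (n : ℕ) : (shiftedT (n + 1)).coeff (n + 1) = 2 ^ n * (-2) ^ (n + 1) := by
  have h : (shiftedT (n + 1)).leadingCoeff = 2 ^ n * (-2) ^ (n + 1) := by
    rw [shiftedT, leadingCoeff_comp (by rw [natDegree_one_sub_two_mul_X]; exact one_ne_zero),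
      leadingCoeff_one_sub_two_mul_X, Chebyshev.natDegree_T,
      Chebyshev.leadingCoeff_T, Int.natAbs_natCast, Nat.add_sub_cancel]
  rwa [leadingCoeff, natDegree_shiftedT] at h

theorem sin_two_mul_mul_eval_shiftedU (n : ℕ) (τ : ℝ) :
    Real.sin (2 * τ) * (shiftedU n).eval (Real.sin τ ^ 2) = Real.sin (2 * ((n + 1) * τ)) := by
  have h : (1 : ℝ) - 2 * Real.sin τ ^ 2 = Real.cos (2 * τ) := by
    rw [Real.cos_two_mul, Real.cos_sq']; ring
  rw [shiftedU, eval_comp]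
  simp only [eval_sub, eval_one, eval_mul, eval_ofNat, eval_X]
  rw [h, mul_comm, Chebyshev.U_real_cos]
  push_cast
  ring_nf

theorem eval_shiftedT_sin_sq (n : ℕ) (τ : ℝ) :
    (shiftedT n).eval (Real.sin τ ^ 2) = Real.cos (2 * (n * τ)) := by
  have h : (1 : ℝ) - 2 * Real.sin τ ^ 2 = Real.cos (2 * τ) := by
    rw [Real.cos_two_mul, Real.cos_sq']; ring
  rw [shiftedT, eval_comp]
  simp only [eval_sub, eval_one, eval_mul, eval_ofNat, eval_X]
  rw [h, Chebyshev.T_real_cos]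
  push_cast
  ring_nf

theorem eval_zero_shiftedU (n : ℕ) : (shiftedU n).eval 0 = n + 1 := by
  simp [shiftedU, eval_comp]

theorem eval_zero_shiftedT (n : ℕ) : (shiftedT n).eval 0 = 1 := by
  simp [shiftedT, eval_comp]

theorem eval_one_shiftedU (n : ℕ) : (shiftedU n).eval 1 = (-1) ^ n * (n + 1) := by
  rw [shiftedU, eval_comp]
  simp only [eval_sub, eval_one, eval_mul, eval_ofNat, eval_X]
  rw [show (1 : ℝ) - 2 * 1 = -1 by norm_num, Chebyshev.U_eval_neg_one,
    Int.cast_negOnePow_natCast]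
  push_cast
  ring

theorem eval_one_shiftedT (n : ℕ) : (shiftedT n).eval 1 = (-1) ^ n := by
  rw [shiftedT, eval_comp]
  simp only [eval_sub, eval_one, eval_mul, eval_ofNat, eval_X]
  rw [show (1 : ℝ) - 2 * 1 = -1 by norm_num, Chebyshev.T_eval_neg_one,
    Int.cast_negOnePow_natCast]

/-- The way to compute `W'` at a root from a trigonometric formula: differentiating the product, the
term containing `W` vanishes and the other carries the factor `sin² 2τ`. -/
theorem derivative_eval_sin_sq {W : ℝ[X]} {G : ℝ → ℝ} {g τ : ℝ}
    (hG : ∀ t, Real.sin (2 * t) * W.eval (Real.sin t ^ 2) = G t) (hg : HasDerivAt G g τ)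
    (h0 : W.eval (Real.sin τ ^ 2) = 0) :
    4 * Real.sin τ ^ 2 * (1 - Real.sin τ ^ 2) * W.derivative.eval (Real.sin τ ^ 2) = g := by
  have h1 : HasDerivAt (fun t : ℝ => Real.sin (2 * t)) (Real.cos (2 * τ) * 2) τ := by
    simpa using ((hasDerivAt_id τ).const_mul 2).sin
  have h2 : HasDerivAt (fun t => W.eval (Real.sin t ^ 2))
      (W.derivative.eval (Real.sin τ ^ 2) * (2 * Real.sin τ * Real.cos τ)) τ := by
    have h3 := (Real.hasDerivAt_sin τ).pow 2
    simp only [Nat.cast_ofNat, Nat.add_one_sub_one, pow_one] at h3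
    exact (W.hasDerivAt (Real.sin τ ^ 2)).comp τ h3
  have h4 := h1.mul h2
  have h5 : (fun t : ℝ => Real.sin (2 * t)) * (fun t => W.eval (Real.sin t ^ 2)) = G :=
    funext hG
  rw [h5] at h4
  rw [hg.unique h4, h0, ← Real.cos_sq', Real.sin_two_mul]
  ring

/-- The roots `sin² (π i / (2 (n + 1)))` of the Chebyshev polynomial on `[0, 1]`, and the end
points. -/
noncomputable def chebNode (n i : ℕ) : ℝ :=
  Real.sin (Real.pi * (i : ℝ) / (2 * ((n : ℝ) + 1))) ^ 2

theorem sin_sq_lt_sin_sq {a b : ℝ} (ha : 0 ≤ a) (hab : a < b) (hb : b ≤ Real.pi / 2) :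
    Real.sin a ^ 2 < Real.sin b ^ 2 := by
  have h1 := Real.sin_lt_sin_of_lt_of_le_pi_div_two (by linarith [Real.pi_pos]) hb hab
  have h2 := Real.sin_nonneg_of_nonneg_of_le_pi ha (by linarith [Real.pi_pos])
  exact pow_lt_pow_left₀ h1 h2 two_ne_zero

theorem weightedNodes_chebNode (n : ℕ) :
    WeightedNodes n (chebNode n) (shiftedU n) (C ((n : ℝ) + 1)) := by
  have hN : (0 : ℝ) < n + 1 := by positivity
  have hang : ∀ i : ℕ, ((n : ℝ) + 1) * (Real.pi * i / (2 * (n + 1))) = i * Real.pi / 2 := by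
    intro i; field_simp
  have hlt : ∀ i ≤ n, chebNode n i < chebNode n (i + 1) := by
    intro i hi
    refine sin_sq_lt_sin_sq (by positivity) ?_ ?_
    · rw [div_lt_div_iff_of_pos_right (by positivity)]
      push_cast
      linarith [Real.pi_pos]
    · rw [div_le_div_iff₀ (by positivity) two_pos]
      have : ((i + 1 : ℕ) : ℝ) ≤ n + 1 := by exact_mod_cast Nat.succ_le_succ hi
      nlinarith [Real.pi_pos]
  have h0 : chebNode n 0 = 0 := by simp [chebNode]
  have hpos : ∀ i ≤ n + 1, 1 ≤ i → 0 < chebNode n i := by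
    intro i hi hi'
    induction i with
    | zero => omega
    | succ i ih =>
      rcases Nat.eq_zero_or_pos i with h | h
      · subst h
        exact h0 ▸ hlt 0 (by omega)
      · exact (ih (by omega) h).trans (hlt i (by omega))
  have hroot : ∀ i, 1 ≤ i → i ≤ n → (shiftedU n).eval (chebNode n i) = 0 := by
    intro i hi hi'
    have h1 := sin_two_mul_mul_eval_shiftedU n (Real.pi * i / (2 * (n + 1)))
    rw [hang, show 2 * ((i : ℝ) * Real.pi / 2) = i * Real.pi by ring, Real.sin_nat_mul_pi] at h1
    refine (mul_eq_zero.1 h1).resolve_left ?_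
    refine (Real.sin_pos_of_pos_of_lt_pi ?_ ?_).ne'
    · have : (0 : ℝ) < i := by exact_mod_cast hi
      have := Real.pi_pos
      positivity
    · rw [← mul_div_assoc, div_lt_iff₀ (by positivity)]
      have : (i : ℝ) < n + 1 := by exact_mod_cast Nat.lt_succ_of_le hi'
      nlinarith [Real.pi_pos]
  refine ⟨h0, ?_, hlt, natDegree_shiftedU n, hroot, ?_, ?_, ?_, ?_⟩
  · have : Real.pi * ((n + 1 : ℕ) : ℝ) / (2 * ((n : ℝ) + 1)) = Real.pi / 2 := by
      push_cast; field_simp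
    rw [chebNode, this, Real.sin_pi_div_two, one_pow]
  · intro i hi hi'
    have hg : HasDerivAt (fun t : ℝ => Real.sin (2 * ((n + 1) * t)))
        (Real.cos (2 * ((n + 1) * (Real.pi * i / (2 * (n + 1))))) * (2 * (n + 1)))
        (Real.pi * i / (2 * (n + 1))) := by
      simpa using (((hasDerivAt_id (Real.pi * (i : ℝ) / (2 * (n + 1)))).const_mul
        ((n : ℝ) + 1)).const_mul 2).sin
    have h1 := derivative_eval_sin_sq (sin_two_mul_mul_eval_shiftedU n) hg (hroot i hi hi')
    rw [hang, show 2 * ((i : ℝ) * Real.pi / 2) = i * Real.pi by ring, Real.cos_nat_mul_pi] at h1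
    rw [eval_C, chebNode]
    linear_combination (1 / 2) * h1
  · rw [eval_zero_shiftedU, eval_C]
  · rw [eval_one_shiftedU, eval_C]
  · intro t _
    rw [eval_C]
    positivity

theorem alternatingNodes_chebNode (n : ℕ) : AlternatingNodes n n (chebNode n) :=
  (weightedNodes_chebNode n).alternatingNodes (by rw [natDegree_C, add_zero])

/-- The polynomial whose roots are the sign changes of the extremal functions. -/
noncomputable def zolotarevPoly (n : ℕ) (s : ℝ) : ℝ[X] :=
  shiftedU n * (1 - C (1 + s ^ 2) * X) + C s * shiftedT (n + 1)

/-- The weight of the roots of `zolotarevPoly`. -/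
noncomputable def zolotarevWeight (n : ℕ) (s : ℝ) : ℝ[X] :=
  C (((n : ℝ) + 1 + s)) * (1 - X) + C (((n : ℝ) + 1) * s ^ 2 + s) * X

theorem eval_zolotarevWeight (n : ℕ) (s t : ℝ) :
    (zolotarevWeight n s).eval t =
      ((n : ℝ) + 1 + s) * (1 - t) + (((n : ℝ) + 1) * s ^ 2 + s) * t := by
  simp only [zolotarevWeight, eval_add, eval_mul, eval_sub, eval_C, eval_X, eval_one]

theorem natDegree_zolotarevWeight_le (n : ℕ) (s : ℝ) : (zolotarevWeight n s).natDegree ≤ 1 := by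
  unfold zolotarevWeight
  compute_degree!

theorem zolotarevWeight_pos (n : ℕ) {s : ℝ} (hs : 0 < s) {t : ℝ} (ht : t ∈ Icc (0 : ℝ) 1) :
    0 < (zolotarevWeight n s).eval t := by
  rw [eval_zolotarevWeight]
  have h1 : 0 < ((n : ℝ) + 1 + s) := by positivity
  have h2 : 0 < (((n : ℝ) + 1) * s ^ 2 + s) := by positivity
  rcases eq_or_lt_of_le ht.1 with h | h
  · rw [← h]; linarith
  · have := mul_pos h2 h
    have := mul_nonneg h1.le (sub_nonneg.2 ht.2)
    linarith

/-- The two top coefficients add up to a nonzero multiple of `-(1 + s²) - 2 s = -(1 + s)²`, so the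
degree does not drop. -/
theorem natDegree_zolotarevPoly (n : ℕ) {s : ℝ} (hs : 0 < s) :
    (zolotarevPoly n s).natDegree = n + 1 := by
  have hlin : (1 - C (1 + s ^ 2) * X : ℝ[X]) = C (-(1 + s ^ 2)) * X + C 1 := by
    simp only [C_neg, map_one]; ring
  have hd1 : (1 - C (1 + s ^ 2) * X : ℝ[X]).natDegree ≤ 1 := by
    rw [hlin]; exact natDegree_linear_le
  refine natDegree_eq_of_le_of_coeff_ne_zero ?_ ?_
  · refine (natDegree_add_le _ _).trans (max_le ?_ ?_)
    · refine natDegree_mul_le.trans ?_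
      rw [natDegree_shiftedU]
      omega
    · refine (natDegree_C_mul_le _ _).trans ?_
      rw [natDegree_shiftedT]
  · rw [zolotarevPoly, coeff_add, coeff_C_mul, coeff_shiftedT_succ,
      coeff_mul_add_eq_of_natDegree_le (natDegree_shiftedU n).le hd1, coeff_shiftedU, hlin]
    have e : (C (-(1 + s ^ 2)) * X + C 1 : ℝ[X]).coeff 1 = -(1 + s ^ 2) := by
      rw [coeff_add, coeff_C_mul, coeff_X_one, coeff_C_succ, mul_one, add_zero]
    have e2 : (2 : ℝ) ^ n * (-2) ^ n * -(1 + s ^ 2) + s * (2 ^ n * (-2) ^ (n + 1)) =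
        -(2 ^ n * (-2) ^ n * (1 + s) ^ 2) := by ring
    rw [e, e2, neg_ne_zero]
    have : (1 + s) ≠ 0 := by positivity
    simp [this]

/-- The angle `τ` is the `i`-th solution of `(n + 1) τ + arctan (s tan τ) = i π / 2`. -/
structure ZolotarevAngle (n : ℕ) (s : ℝ) (i : ℕ) (τ : ℝ) : Prop where
  lower : ((i : ℝ) - 1) * Real.pi / (2 * ((n : ℝ) + 1)) < τ
  upper : τ < (i : ℝ) * Real.pi / (2 * ((n : ℝ) + 1))
  eq : Real.sin (i * Real.pi / 2 - (n + 1) * τ) * Real.cos τ =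
    s * Real.sin τ * Real.cos (i * Real.pi / 2 - (n + 1) * τ)

/-- With `μ = iπ/2 - (n + 1)τ` the equation is `tan μ = s tan τ`. On the prescribed interval `μ`
falls from `π/2` to `0`, and the form without denominators has opposite signs at the ends. -/
theorem exists_zolotarevAngle (n : ℕ) {s : ℝ} (hs : 0 < s) {i : ℕ} (hi : 1 ≤ i)
    (hi' : i ≤ n + 1) : ∃ τ, ZolotarevAngle n s i τ := by
  have hN : (0 : ℝ) < n + 1 := by positivity
  have hpi := Real.pi_pos
  have hi1 : (1 : ℝ) ≤ i := by exact_mod_cast hi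
  have hi2 : (i : ℝ) ≤ n + 1 := by exact_mod_cast hi'
  set a := ((i : ℝ) - 1) * Real.pi / (2 * ((n : ℝ) + 1)) with ha
  set b := (i : ℝ) * Real.pi / (2 * ((n : ℝ) + 1)) with hb
  have hab : a < b := by
    rw [ha, hb, div_lt_div_iff_of_pos_right (by positivity)]
    nlinarith
  have ha0 : 0 ≤ a := div_nonneg (mul_nonneg (by linarith) hpi.le) (by positivity)
  have hb1 : b ≤ Real.pi / 2 := by
    rw [hb, div_le_div_iff₀ (by positivity) two_pos]
    nlinarith
  have hNa : i * Real.pi / 2 - (n + 1) * a = Real.pi / 2 := by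
    rw [ha]; field_simp; ring
  have hNb : i * Real.pi / 2 - (n + 1) * b = 0 := by
    rw [hb]; field_simp; ring
  let f : ℝ → ℝ := fun τ => s * Real.sin τ * Real.cos (i * Real.pi / 2 - (n + 1) * τ) -
    Real.sin (i * Real.pi / 2 - (n + 1) * τ) * Real.cos τ
  have hf : ContinuousOn f (Icc a b) := by fun_prop
  have hfa : f a < 0 := by
    simp only [f, hNa, Real.cos_pi_div_two, Real.sin_pi_div_two]
    have := Real.cos_pos_of_mem_Ioo (x := a) ⟨by linarith, by linarith⟩
    linarith
  have hfb : 0 < f b := by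
    simp only [f, hNb, Real.cos_zero, Real.sin_zero]
    have := Real.sin_pos_of_pos_of_lt_pi (x := b) (by linarith) (by linarith)
    have := mul_pos hs this
    linarith
  obtain ⟨τ, hτ, h0⟩ := intermediate_value_Ioo hab.le hf ⟨hfa, hfb⟩
  exact ⟨τ, hτ.1, hτ.2, by simp only [f] at h0; linarith⟩

theorem ZolotarevAngle.mem_Ioo {n : ℕ} {s : ℝ} {i : ℕ} {τ : ℝ} (h : ZolotarevAngle n s i τ)
    (hi : 1 ≤ i) (hi' : i ≤ n + 1) : τ ∈ Ioo 0 (Real.pi / 2) := by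
  have hN : (0 : ℝ) < n + 1 := by positivity
  have hpi := Real.pi_pos
  have hi1 : (1 : ℝ) ≤ i := by exact_mod_cast hi
  have hi2 : (i : ℝ) ≤ n + 1 := by exact_mod_cast hi'
  refine ⟨lt_of_le_of_lt (div_nonneg (mul_nonneg (by linarith) hpi.le) (by positivity)) h.lower,
    lt_of_lt_of_le h.upper ?_⟩
  rw [div_le_div_iff₀ (by positivity) two_pos]
  nlinarith

/-- Up to `(-1) ^ i` this is the imaginary part of the square of `(cos τ + √(-1) s sin τ) exp(-√(-1)
μ)`, `μ = iπ/2 - (n + 1)τ`, written as twice the product of imaginary and real parts. The first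
factor vanishes exactly when the equation of `ZolotarevAngle` holds. -/
theorem sin_two_mul_mul_eval_zolotarevPoly (n : ℕ) (s : ℝ) (i : ℕ) (τ : ℝ) :
    Real.sin (2 * τ) * (zolotarevPoly n s).eval (Real.sin τ ^ 2) =
      2 * (-1) ^ i * ((s * Real.sin τ * Real.cos (i * Real.pi / 2 - (n + 1) * τ) -
        Real.sin (i * Real.pi / 2 - (n + 1) * τ) * Real.cos τ) *
      (Real.cos τ * Real.cos (i * Real.pi / 2 - (n + 1) * τ) +
        s * Real.sin τ * Real.sin (i * Real.pi / 2 - (n + 1) * τ))) := by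
  have h1 := sin_two_mul_mul_eval_shiftedU n τ
  have h2 := eval_shiftedT_sin_sq (n + 1) τ
  set μ := i * Real.pi / 2 - (n + 1) * τ with hμ
  have h3 : 2 * (((n : ℝ) + 1) * τ) = i * Real.pi - 2 * μ := by rw [hμ]; ring
  push_cast at h2
  rw [h3, Real.sin_nat_mul_pi_sub, Real.sin_two_mul μ] at h1
  rw [h3, Real.cos_nat_mul_pi_sub, Real.cos_two_mul'] at h2
  have e : Real.sin (2 * τ) * (zolotarevPoly n s).eval (Real.sin τ ^ 2) =
      (Real.sin (2 * τ) * (shiftedU n).eval (Real.sin τ ^ 2)) *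
        (1 - (1 + s ^ 2) * Real.sin τ ^ 2) +
      Real.sin (2 * τ) * s * (shiftedT (n + 1)).eval (Real.sin τ ^ 2) := by
    simp only [zolotarevPoly, eval_add, eval_mul, eval_sub, eval_one, eval_C, eval_X]
    ring
  rw [e, h1, h2, Real.sin_two_mul τ]
  have h4 := Real.sin_sq_add_cos_sq τ
  linear_combination 2 * (-1) ^ i * Real.sin μ * Real.cos μ * h4

theorem eval_zolotarevWeight_sin_sq (n : ℕ) (s τ : ℝ) :
    (zolotarevWeight n s).eval (Real.sin τ ^ 2) =
      ((n : ℝ) + 1) * (Real.cos τ ^ 2 + s ^ 2 * Real.sin τ ^ 2) + s := by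
  rw [eval_zolotarevWeight, ← Real.cos_sq']
  have h4 := Real.sin_sq_add_cos_sq τ
  linear_combination s * h4

/-- The nodes are ordered since the angles lie in successive intervals of length `π / (2 (n + 1))`.
The derivative condition comes from differentiating the factored trigonometric form at a zero of its
first factor. -/
theorem weightedNodes_zolotarev (n : ℕ) {s : ℝ} (hs : 0 < s) {τ : ℕ → ℝ} (h0 : τ 0 = 0)
    (h1 : τ (n + 2) = Real.pi / 2) (h : ∀ i, 1 ≤ i → i ≤ n + 1 → ZolotarevAngle n s i (τ i)) :
    WeightedNodes (n + 1) (fun i => Real.sin (τ i) ^ 2) (zolotarevPoly n s)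
      (zolotarevWeight n s) := by
  have hroot : ∀ i, 1 ≤ i → i ≤ n + 1 → (zolotarevPoly n s).eval (Real.sin (τ i) ^ 2) = 0 := by
    intro i hi hi'
    have h2 := sin_two_mul_mul_eval_zolotarevPoly n s i (τ i)
    rw [(h i hi hi').eq, sub_self, zero_mul, mul_zero] at h2
    have h3 := (h i hi hi').mem_Ioo hi hi'
    exact (mul_eq_zero.1 h2).resolve_left
      (Real.sin_pos_of_pos_of_lt_pi (by linarith [h3.1]) (by linarith [h3.2])).ne'
  refine ⟨by simp [h0], by simp [h1], ?_, natDegree_zolotarevPoly n hs, hroot, ?_, ?_, ?_,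
    fun t ht => zolotarevWeight_pos n hs ht⟩
  · intro i hi
    rcases Nat.eq_zero_or_pos i with hi0 | hi0
    · subst hi0
      have h3 := (h 1 le_rfl (by omega)).mem_Ioo le_rfl (by omega)
      exact sin_sq_lt_sin_sq h0.ge (h0 ▸ h3.1) h3.2.le
    · have h3 := (h i hi0 hi).mem_Ioo hi0 hi
      rcases (by omega : i ≤ n ∨ i = n + 1) with hi1 | hi1
      · have h4 := (h (i + 1) (by omega) (by omega)).mem_Ioo (by omega) (by omega)
        refine sin_sq_lt_sin_sq h3.1.le ?_ h4.2.le
        have h5 := (h (i + 1) (by omega) (by omega)).lower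
        have h6 := (h i hi0 hi).upper
        push_cast at h5
        rw [add_sub_cancel_right] at h5
        exact h6.trans h5
      · subst hi1
        exact sin_sq_lt_sin_sq h3.1.le (h1.symm ▸ h3.2) h1.le
  · intro i hi hi'
    set A := Real.cos (i * Real.pi / 2 - (n + 1) * τ i) with hA
    set B := Real.sin (i * Real.pi / 2 - (n + 1) * τ i) with hB
    have hAB : B ^ 2 + A ^ 2 = 1 := Real.sin_sq_add_cos_sq _
    have heq := (h i hi hi').eq
    rw [← hA, ← hB] at heq
    have dμ : HasDerivAt (fun t : ℝ => i * Real.pi / 2 - (n + 1) * t) (-(n + 1)) (τ i) := by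
      simpa using ((hasDerivAt_id (τ i)).const_mul ((n : ℝ) + 1)).const_sub (i * Real.pi / 2)
    have dA := dμ.cos
    have dB := dμ.sin
    have dc := Real.hasDerivAt_cos (τ i)
    have ds := (Real.hasDerivAt_sin (τ i)).const_mul s
    have hg := (((ds.mul dA).sub (dB.mul dc)).mul ((dc.mul dA).add (ds.mul dB))).const_mul
      (2 * (-1) ^ i)
    have h2 := derivative_eval_sin_sq (sin_two_mul_mul_eval_zolotarevPoly n s i) hg
      (hroot i hi hi')
    simp only [Pi.mul_apply, Pi.add_apply, Pi.sub_apply] at h2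
    rw [← hA, ← hB] at h2
    rw [eval_zolotarevWeight_sin_sq]
    have h4 := Real.sin_sq_add_cos_sq (τ i)
    set c := Real.cos (τ i)
    set σ := Real.sin (τ i)
    linear_combination (1 / 2) * h2 - (-1) ^ i * (-((n : ℝ) + 1) * (s * σ * A - B * c) +
      (s * c * B - σ * A) + (-σ * A + c * (n + 1) * B + s * c * B - s * σ * (n + 1) * A)) * heq +
      (-1) ^ i * ((n + 1) * (c ^ 2 + s ^ 2 * σ ^ 2) + s * (c ^ 2 + σ ^ 2)) * hAB +
      (-1) ^ i * s * h4
  · rw [eval_zolotarevWeight]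
    simp only [zolotarevPoly, eval_add, eval_mul, eval_sub, eval_one, eval_C, eval_X,
      eval_zero_shiftedU, eval_zero_shiftedT]
    ring
  · rw [eval_zolotarevWeight]
    simp only [zolotarevPoly, eval_add, eval_mul, eval_sub, eval_one, eval_C, eval_X,
      eval_one_shiftedU, eval_one_shiftedT]
    ring

end

/-! ### The nodes of the family as functions of the parameter -/

theorem ZolotarevAngle.shift_mem_Ioo {n : ℕ} {s : ℝ} {i : ℕ} {τ : ℝ}
    (h : ZolotarevAngle n s i τ) :
    i * Real.pi / 2 - (n + 1) * τ ∈ Ioo 0 (Real.pi / 2) := by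
  have hN : (0 : ℝ) < n + 1 := by positivity
  have h1 := h.lower
  have h2 := h.upper
  rw [div_lt_iff₀ (by positivity)] at h1
  rw [lt_div_iff₀ (by positivity)] at h2
  constructor <;> linarith

/-- Every point of `(0, 1)` other than the Chebyshev nodes is a node of the family. -/
theorem exists_zolotarevAngle_sin_sq_eq (n : ℕ) {a : ℝ} (ha : a ∈ Ioo (0 : ℝ) 1)
    (hne : ∀ j, 1 ≤ j → j ≤ n → a ≠ chebNode n j) :
    ∃ s k τ, 0 < s ∧ 1 ≤ k ∧ k ≤ n + 1 ∧ ZolotarevAngle n s k τ ∧ Real.sin τ ^ 2 = a := by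
  have hN : (0 : ℝ) < n + 1 := by positivity
  have hpi := Real.pi_pos
  set τ := Real.arcsin √a with hτ
  have hs1 : √a < 1 := by
    rw [Real.sqrt_lt' one_pos]; simpa using ha.2
  have hs0 : 0 < √a := Real.sqrt_pos.2 ha.1
  have hsin : Real.sin τ = √a := Real.sin_arcsin (by linarith) hs1.le
  have hτ0 : 0 < τ := Real.arcsin_pos.2 hs0
  have hτ1 : τ < Real.pi / 2 := Real.arcsin_lt_pi_div_two.2 hs1
  have hsq : Real.sin τ ^ 2 = a := by rw [hsin, Real.sq_sqrt ha.1.le]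
  set z := τ * (2 * (n + 1)) / Real.pi with hz
  have hz0 : 0 < z := by positivity
  -- The ceiling selects the interval between consecutive Chebyshev angles containing `τ`; as `a` is
  -- not a Chebyshev node, `z` is not an integer. The parameter is then `s = tan μ / tan τ`, `μ =
  -- kπ/2 - (n + 1)τ`.
  set k := ⌈z⌉₊ with hk
  have hk1 : 1 ≤ k := Nat.ceil_pos.2 hz0
  have hzN : z < n + 1 := by
    rw [hz, div_lt_iff₀ hpi]
    nlinarith
  have hkN : k ≤ n + 1 := by
    rw [hk, Nat.ceil_le]
    push_cast
    exact hzN.le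
  have hzk : z < k := by
    refine lt_of_le_of_ne (Nat.le_ceil z) fun h => ?_
    have h1 : τ = Real.pi * k / (2 * ((n : ℝ) + 1)) := by
      rw [← h, hz]; field_simp
    rcases (by omega : k ≤ n ∨ k = n + 1) with h2 | h2
    · refine hne k hk1 h2 ?_
      rw [chebNode, ← h1, hsq]
    · rw [h2] at h
      push_cast at h
      exact hzN.ne h
  have hzk' : (k : ℝ) - 1 < z := by
    have := Nat.ceil_lt_add_one hz0.le
    linarith
  have hlow : ((k : ℝ) - 1) * Real.pi / (2 * ((n : ℝ) + 1)) < τ := by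
    rw [div_lt_iff₀ (by positivity)]
    rwa [hz, lt_div_iff₀ hpi] at hzk'
  have hup : τ < (k : ℝ) * Real.pi / (2 * ((n : ℝ) + 1)) := by
    rw [lt_div_iff₀ (by positivity)]
    rwa [hz, div_lt_iff₀ hpi] at hzk
  have hμ : k * Real.pi / 2 - (n + 1) * τ ∈ Ioo 0 (Real.pi / 2) := by
    have h1 := hlow
    have h2 := hup
    rw [div_lt_iff₀ (by positivity)] at h1
    rw [lt_div_iff₀ (by positivity)] at h2
    constructor <;> linarith
  have p1 := Real.sin_pos_of_pos_of_lt_pi hμ.1 (by linarith [hμ.2])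
  have p2 := Real.cos_pos_of_mem_Ioo ⟨by linarith [hμ.1], hμ.2⟩
  have p3 := Real.sin_pos_of_pos_of_lt_pi hτ0 (by linarith)
  have p4 := Real.cos_pos_of_mem_Ioo ⟨by linarith, hτ1⟩
  refine ⟨Real.sin (k * Real.pi / 2 - (n + 1) * τ) * Real.cos τ /
    (Real.sin τ * Real.cos (k * Real.pi / 2 - (n + 1) * τ)), k, τ, by positivity, hk1, hkN,
    ⟨hlow, hup, ?_⟩, hsq⟩
  rw [mul_assoc (_ / _), div_mul_cancel₀ _ (mul_pos p3 p2).ne']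

/-- The nodes of the family move differentiably. -/
theorem ZolotarevAngle.exists_curve {n : ℕ} {s₀ : ℝ} (hs₀ : 0 < s₀) {i : ℕ} (hi : 1 ≤ i)
    (hi' : i ≤ n + 1) {τ₀ : ℝ} (h : ZolotarevAngle n s₀ i τ₀) :
    ∃ φ : ℝ → ℝ, φ s₀ = τ₀ ∧ (∀ᶠ s in nhds s₀, ZolotarevAngle n s i (φ s)) ∧
      HasDerivAt (fun s => Real.sin (φ s) ^ 2)
        (-2 * (Real.sin τ₀ ^ 2 * (1 - Real.sin τ₀ ^ 2) /
          (zolotarevWeight n s₀).eval (Real.sin τ₀ ^ 2))) s₀ := by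
  have hτ := h.mem_Ioo hi hi'
  have hμ := h.shift_mem_Ioo
  have p1 := Real.sin_pos_of_pos_of_lt_pi hμ.1 (by linarith [hμ.2, Real.pi_pos])
  have p2 := Real.cos_pos_of_mem_Ioo ⟨by linarith [hμ.1, Real.pi_pos], hμ.2⟩
  have p3 := Real.sin_pos_of_pos_of_lt_pi hτ.1 (by linarith [hτ.2, Real.pi_pos])
  have p4 := Real.cos_pos_of_mem_Ioo ⟨by linarith [hτ.1, Real.pi_pos], hτ.2⟩
  -- The parameter is an explicit function `tan μ / tan τ` of the angle with nonzero derivative, so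
  -- the curve is its local inverse and no implicit function is needed.
  let f : ℝ → ℝ := fun τ => Real.sin (i * Real.pi / 2 - (n + 1) * τ) * Real.cos τ /
    (Real.sin τ * Real.cos (i * Real.pi / 2 - (n + 1) * τ))
  have hf0 : f τ₀ = s₀ := by
    simp only [f]
    rw [div_eq_iff (by positivity), h.eq]
    ring
  set A := Real.cos (i * Real.pi / 2 - (n + 1) * τ₀) with hA
  set B := Real.sin (i * Real.pi / 2 - (n + 1) * τ₀) with hB
  set c := Real.cos τ₀ with hc
  set σ := Real.sin τ₀ with hσ
  have hL : (zolotarevWeight n s₀).eval (σ ^ 2) =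
      ((n : ℝ) + 1) * (c ^ 2 + s₀ ^ 2 * σ ^ 2) + s₀ := eval_zolotarevWeight_sin_sq n s₀ τ₀
  have hLpos : 0 < (zolotarevWeight n s₀).eval (σ ^ 2) := by
    rw [hL]; positivity
  have heq := h.eq
  rw [← hA, ← hB, ← hc, ← hσ] at heq
  have hcσ : σ ^ 2 + c ^ 2 = 1 := Real.sin_sq_add_cos_sq _
  have hder : HasStrictDerivAt f (-((zolotarevWeight n s₀).eval (σ ^ 2) / (c * σ))) τ₀ := by
    have dμ : HasStrictDerivAt (fun t : ℝ => i * Real.pi / 2 - (n + 1) * t) (-(n + 1)) τ₀ := by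
      simpa using ((hasStrictDerivAt_id τ₀).const_mul ((n : ℝ) + 1)).const_sub (i * Real.pi / 2)
    have dA := dμ.cos
    have dB := dμ.sin
    have dc := Real.hasStrictDerivAt_cos τ₀
    have ds := Real.hasStrictDerivAt_sin τ₀
    have hg : HasStrictDerivAt f _ τ₀ := (dB.mul dc).div (ds.mul dA) (mul_pos p3 p2).ne'
    simp only [Pi.mul_apply] at hg
    rw [← hA, ← hB, ← hc, ← hσ] at hg
    refine Eq.mp (congrArg (fun d => HasStrictDerivAt f d τ₀) ?_) hg
    symm
    rw [hL]
    rw [eq_div_iff (by positivity), neg_mul, div_mul_eq_mul_div, neg_eq_iff_eq_neg,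
      div_eq_iff (by positivity)]
    linear_combination -(((n : ℝ) + 1) * σ ^ 2 * (B * c + s₀ * σ * A) + σ * A) * heq -
      A * B * c * σ * hcσ
  have hne : -((zolotarevWeight n s₀).eval (σ ^ 2) / (c * σ)) ≠ 0 := by
    rw [neg_ne_zero]; positivity
  have hinv := hder.to_localInverse hne
  have hright := (hder.hasStrictFDerivAt_equiv hne).eventually_right_inverse
  set φ := hder.localInverse f _ τ₀ hne with hφ
  rw [hf0] at hinv hright
  have hφ0 : φ s₀ = τ₀ := by
    rw [← hf0]
    exact (hder.hasStrictFDerivAt_equiv hne).localInverse_apply_image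
  have hcont : ContinuousAt φ s₀ := hinv.hasDerivAt.continuousAt
  refine ⟨φ, hφ0, ?_, ?_⟩
  · have e1 : ∀ᶠ s in nhds s₀, φ s ∈ Ioo (((i : ℝ) - 1) * Real.pi / (2 * ((n : ℝ) + 1)))
        ((i : ℝ) * Real.pi / (2 * ((n : ℝ) + 1))) :=
      hcont.eventually_mem (by rw [hφ0]; exact Ioo_mem_nhds h.lower h.upper)
    have e2 : ∀ᶠ s in nhds s₀,
        Real.sin (φ s) * Real.cos (i * Real.pi / 2 - (n + 1) * φ s) ≠ 0 := by
      have : ContinuousAt (fun s => Real.sin (φ s) *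
        Real.cos (i * Real.pi / 2 - (n + 1) * φ s)) s₀ := by fun_prop
      refine this.eventually_ne ?_
      rw [hφ0]
      exact (mul_pos p3 p2).ne'
    filter_upwards [e1, e2, hright] with s h1 h2 h3
    refine ⟨h1.1, h1.2, ?_⟩
    have h4 : f (φ s) = s := h3
    simp only [f] at h4
    rw [div_eq_iff h2] at h4
    rw [h4]
    ring
  · refine (hinv.hasDerivAt.sin.pow 2).congr_deriv ?_
    rw [hφ0, ← hσ, ← hc, ← eq_sub_iff_add_eq'.2 hcσ]
    simp only [Nat.cast_ofNat, Nat.add_one_sub_one, pow_one]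
    field_simp

/-! ### Interpolation of the step function at the nodes -/

namespace AlternatingNodes
open Polynomial
variable {n m : ℕ} {x : ℕ → ℝ}

/-- Interpolation of the step function at a node by a polynomial of degree less than `n` at the
other nodes, including an end point if there are too few nodes. -/
theorem exists_interpolation (h : AlternatingNodes n m x) (hn : 1 ≤ n) {k b d : ℕ} (hk : 1 ≤ k)
    (hkm : k ≤ m) (hb : b ≤ 1) (hd : d = m ∨ d = m + 1) (hbd : d = n + b) :
    ∃ p : ℝ[X], p.natDegree < n ∧ (∀ i, b ≤ i → i < k → p.eval (x i) = 1) ∧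
      (∀ i, k < i → i ≤ d → p.eval (x i) = 0) ∧
      ∀ t ∈ Ioo (0 : ℝ) 1,
        0 ≤ (stepFn (x k) t - p.eval t) * ((-1) ^ (k + 1) * (nodePoly m x).eval t) := by
  -- The relation `d = n + b` leaves exactly `n` conditions. With `m = n + 1` the interior nodes
  -- suffice; with `m = n` one end point must be added, `0` when `b = 0` and `1` when `d = m + 1`.
  set J := (Finset.Icc b d).erase k with hJ
  have hkJ : k ∈ Finset.Icc b d := Finset.mem_Icc.2 ⟨by omega, by omega⟩
  have hcard : J.card = n := by
    rw [hJ, Finset.card_erase_of_mem hkJ, Nat.card_Icc]; omega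
  have hJd : ∀ i ∈ J, b ≤ i ∧ i ≤ d ∧ i ≠ k := fun i hi => by
    have h1 := Finset.mem_erase.1 hi
    have h2 := Finset.mem_Icc.1 h1.2
    exact ⟨h2.1, h2.2, h1.1⟩
  have hinj : Set.InjOn x J := h.injOn.mono fun i hi => by
    have := (hJd i hi).2.1
    exact Set.mem_Iic.2 (by omega)
  set p := Lagrange.interpolate J x (fun i => stepFn (x k) (x i)) with hp
  have hpe : ∀ i ∈ J, p.eval (x i) = stepFn (x k) (x i) := fun i hi =>
    Lagrange.eval_interpolate_at_node _ hinj hi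
  have hpd : p.natDegree < n := by
    have h1 := Lagrange.degree_interpolate_lt (fun i => stepFn (x k) (x i)) hinj
    rw [hcard, ← hp] at h1
    by_cases h0 : p = 0
    · rw [h0, natDegree_zero]; omega
    · exact (natDegree_lt_iff_degree_lt h0).2 h1
  refine ⟨p, hpd, fun i hi hi' => ?_, fun i hi hi' => ?_, fun t ht => ?_⟩
  · rw [hpe i (Finset.mem_erase.2 ⟨by omega, Finset.mem_Icc.2 ⟨hi, by omega⟩⟩),
      stepFn_of_le (h.le hi'.le (by omega))]
  · rw [hpe i (Finset.mem_erase.2 ⟨by omega, Finset.mem_Icc.2 ⟨by omega, hi'⟩⟩),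
      stepFn_of_lt (h.lt hi (by omega))]
  · have hT : (J.image x).card = n := by rw [Finset.card_image_of_injOn hinj, hcard]
    have h1 := stepFn_sub_eval_mul_nonneg (a := x k) (t := J.image x) (p := p)
      (by rw [hT]; exact hpd) (fun y hy => by
        obtain ⟨i, hi, rfl⟩ := Finset.mem_image.1 hy
        exact hpe i hi) t
    have h2 : ((J.image x).filter (x k < ·)).card = d - k := by
      rw [Finset.filter_image, Finset.card_image_of_injOn (hinj.mono fun i hi =>
        (Finset.mem_filter.1 hi).1)]
      have : J.filter (fun i => x k < x i) = Finset.Ioc k d := by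
        ext i
        simp only [Finset.mem_filter, Finset.mem_Ioc]
        constructor
        · rintro ⟨hi, hlt⟩
          have h3 := hJd i hi
          refine ⟨?_, h3.2.1⟩
          by_contra hc
          exact absurd hlt (not_lt.2 (h.le (not_lt.1 hc) (by omega)))
        · rintro ⟨hi, hi'⟩
          exact ⟨Finset.mem_erase.2 ⟨by omega, Finset.mem_Icc.2 ⟨by omega, hi'⟩⟩,
            h.lt hi (by omega)⟩
      rw [this, Nat.card_Ioc]
    rw [h2, Finset.prod_image (fun i hi j hj e => hinj hi hj e)] at h1
    have h3 : (x k - t) * ∏ i ∈ J, (t - x i) = -∏ i ∈ Finset.Icc b d, (t - x i) := by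
      rw [← Finset.mul_prod_erase _ _ hkJ]; ring
    have h4 : ∏ i ∈ Finset.Icc 1 m, (t - x i) = (-1) ^ m * (nodePoly m x).eval t := by
      have hc : ((-1 : ℝ)) ^ m = ∏ i ∈ Finset.Icc 1 m, (-1 : ℝ) := by simp
      rw [eval_nodePoly, hc, ← Finset.prod_mul_distrib]
      exact Finset.prod_congr rfl fun i _ => by ring
    -- An end point used as an interpolation node contributes only the factor `t` or `t - 1`, of
    -- constant sign on `(0, 1)`, so it creates no new sign change.
    have h5 : ∃ c > 0, ∏ i ∈ Finset.Icc b d, (t - x i) =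
        c * ((-1) ^ d * (nodePoly m x).eval t) := by
      have h6 : ∃ c > 0, ∏ i ∈ Finset.Icc b m, (t - x i) =
          c * ∏ i ∈ Finset.Icc 1 m, (t - x i) := by
        rcases (by omega : b = 0 ∨ b = 1) with rfl | rfl
        · refine ⟨t, ht.1, ?_⟩
          have e : Finset.Icc 0 m = insert 0 (Finset.Icc 1 m) := by
            ext i; simp only [Finset.mem_insert, Finset.mem_Icc]; omega
          rw [e, Finset.prod_insert (by simp), h.zero, sub_zero]
        · exact ⟨1, one_pos, by rw [one_mul]⟩
      obtain ⟨c, hc, h6⟩ := h6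
      rcases hd with rfl | rfl
      · exact ⟨c, hc, by rw [h6, h4]⟩
      · refine ⟨c * (1 - t), mul_pos hc (sub_pos.2 ht.2), ?_⟩
        have e : Finset.Icc b (m + 1) = insert (m + 1) (Finset.Icc b m) := by
          ext i; simp only [Finset.mem_insert, Finset.mem_Icc]; omega
        rw [e, Finset.prod_insert (by simp), h6, h4, h.one]
        ring
    obtain ⟨c, hc, h5⟩ := h5
    rw [h3, h5] at h1
    have h7 : ((-1 : ℝ)) ^ (d - k) * (-1) ^ d = (-1) ^ k := by
      obtain ⟨e, rfl⟩ : ∃ e, d = k + e := ⟨d - k, by omega⟩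
      rw [Nat.add_sub_cancel_left, pow_add, mul_comm, mul_assoc, ← pow_add, ← two_mul,
        pow_mul]
      simp
    refine nonneg_of_mul_nonneg_right (a := c) ?_ hc
    calc (0 : ℝ) ≤ _ := h1
      _ = _ := by
        rw [pow_succ, ← h7]
        ring

end AlternatingNodes

/-! ### The values at the Chebyshev nodes -/

section
open Polynomial

theorem sin_sq_sub_sin_sq {u β : ℝ} (hβ : Real.cos β ≠ 0) :
    Real.sin (u + β) ^ 2 - Real.sin u ^ 2 =
      Real.tan β / 2 * (Real.sin (2 * (u + β)) + Real.sin (2 * u)) := by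
  have h1 := Real.sin_sq_add_cos_sq u
  have h2 := Real.sin_sq_add_cos_sq β
  have h3 : Real.sin (u + β) ^ 2 - Real.sin u ^ 2 = Real.sin (2 * u + β) * Real.sin β := by
    rw [Real.sin_add, Real.sin_add, Real.sin_two_mul, Real.cos_two_mul]
    linear_combination Real.sin u ^ 2 * h2 - Real.sin β ^ 2 * h1
  have h4 : Real.sin (2 * (u + β)) + Real.sin (2 * u) =
      2 * Real.sin (2 * u + β) * Real.cos β := by
    rw [show 2 * (u + β) = (2 * u + β) + β by ring, Real.sin_add (2 * u + β) β]
    conv_lhs => rw [show Real.sin (2 * u) = Real.sin ((2 * u + β) - β) by ring_nf]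
    rw [Real.sin_sub]
    ring
  rw [h3, h4, Real.tan_eq_sin_div_cos]
  field_simp

theorem cos_pi_div_pos {n : ℕ} (hn : 1 ≤ n) : 0 < Real.cos (Real.pi / (2 * ((n : ℝ) + 1))) := by
  have : (1 : ℝ) ≤ n := by exact_mod_cast hn
  have hpi := Real.pi_pos
  refine Real.cos_pos_of_mem_Ioo ⟨by have : 0 < Real.pi / (2 * ((n : ℝ) + 1)) := by positivity
                                     linarith, ?_⟩
  rw [div_lt_div_iff₀ (by positivity) two_pos]
  nlinarith

theorem tan_pi_div_pos {n : ℕ} (hn : 1 ≤ n) : 0 < Real.tan (Real.pi / (2 * ((n : ℝ) + 1))) := by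
  rw [Real.tan_eq_sin_div_cos]
  refine div_pos (Real.sin_pos_of_pos_of_lt_pi (by have := Real.pi_pos; positivity) ?_)
    (cos_pi_div_pos hn)
  have hpi := Real.pi_pos
  rw [div_lt_iff₀ (by positivity)]
  nlinarith [(Nat.cast_nonneg n : (0 : ℝ) ≤ n)]

theorem chebNode_angle_mem {n i : ℕ} (hi : 1 ≤ i) (hi' : i ≤ n) :
    Real.pi * (i : ℝ) / (2 * ((n : ℝ) + 1)) ∈ Ioo 0 (Real.pi / 2) := by
  have h1 : (1 : ℝ) ≤ i := by exact_mod_cast hi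
  have h2 : (i : ℝ) ≤ n := by exact_mod_cast hi'
  have hpi := Real.pi_pos
  refine ⟨by positivity, ?_⟩
  rw [div_lt_div_iff₀ (by positivity) two_pos]
  nlinarith

theorem envelopeB_chebNode {n i : ℕ} (hi : 1 ≤ i) (hi' : i ≤ n) :
    envelopeB n (chebNode n i) = Real.tan (Real.pi / (2 * ((n : ℝ) + 1))) / 2 *
      Real.sin (2 * (Real.pi * (i : ℝ) / (2 * ((n : ℝ) + 1)))) := by
  have h := chebNode_angle_mem hi hi'
  have h1 := Real.sin_pos_of_pos_of_lt_pi h.1 (by linarith [h.2, Real.pi_pos])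
  have h2 := Real.cos_pos_of_mem_Ioo ⟨by linarith [h.1, Real.pi_pos], h.2⟩
  rw [envelopeB, chebNode, Real.sin_two_mul]
  set u := Real.pi * (i : ℝ) / (2 * ((n : ℝ) + 1))
  have e : Real.sin u ^ 2 - (Real.sin u ^ 2) ^ 2 = (Real.sin u * Real.cos u) ^ 2 := by
    rw [mul_pow, Real.cos_sq']; ring
  rw [e, Real.sqrt_sq (mul_pos h1 h2).le]
  ring

theorem envelopeB_chebNode_pos {n i : ℕ} (hi : 1 ≤ i) (hi' : i ≤ n) :
    0 < envelopeB n (chebNode n i) := by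
  have h := chebNode_angle_mem hi hi'
  rw [envelopeB_chebNode hi hi']
  exact mul_pos (half_pos (tan_pi_div_pos (by omega)))
    (Real.sin_pos_of_pos_of_lt_pi (by linarith [h.1]) (by linarith [h.2]))

/-- By `sin_sq_sub_sin_sq` with `β = π / (2 (n + 1))`, the difference of consecutive nodes is the
sum of the two values of `B_n`, so the alternating sum telescopes. -/
theorem alternatingSum_chebNode {n k : ℕ} (hk : 1 ≤ k) (hkn : k ≤ n) :
    2 * ∑ i ∈ Finset.Ico 1 k, (-1) ^ i * chebNode n i + (-1) ^ k * chebNode n k =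
      (-1) ^ k * envelopeB n (chebNode n k) := by
  have hc := (cos_pi_div_pos (n := n) (by omega)).ne'
  rw [envelopeB_chebNode hk hkn]
  induction k with
  | zero => omega
  | succ k ih =>
    have e : Real.pi * ((k + 1 : ℕ) : ℝ) / (2 * ((n : ℝ) + 1)) =
        Real.pi * (k : ℝ) / (2 * ((n : ℝ) + 1)) + Real.pi / (2 * ((n : ℝ) + 1)) := by
      push_cast; ring
    have key := sin_sq_sub_sin_sq (u := Real.pi * (k : ℝ) / (2 * ((n : ℝ) + 1))) hc
    rcases Nat.eq_zero_or_pos k with hk0 | hk0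
    · subst hk0
      simp only [chebNode, e]
      simp only [CharP.cast_eq_zero, mul_zero, zero_div, zero_add, Real.sin_zero] at key ⊢
      simp only [Finset.Ico_self, Finset.sum_empty]
      linear_combination -key
    · have := ih hk0 (by omega)
      rw [Finset.sum_Ico_succ_top hk0]
      simp only [chebNode, e] at this ⊢
      linear_combination this - (-1) ^ k * key

/-- The error of the interpolant and the integral of the sign function are the same alternating sum,
so the upper and lower bounds meet. -/
theorem pointConst_chebNode {n j : ℕ} (hn : 1 ≤ n) (hj : 1 ≤ j) (hj' : j ≤ n) :
    pointConst n (n - 1) ⊤ (chebNode n j) = ENNReal.ofReal (envelopeB n (chebNode n j)) := by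
  have h := alternatingNodes_chebNode n
  have hS := alternatingSum_chebNode hj hj'
  refine le_antisymm ?_ ?_
  · obtain ⟨p, hp, -, -, hs⟩ := h.exists_interpolation (k := j) (b := 0) hn hj hj' (by omega)
      (Or.inl rfl) rfl
    have hpd : p.degree < n := degree_le_natDegree.trans_lt (by exact_mod_cast hp)
    refine (pointConst_le_integral hn (h.mem_Icc (by omega)) p hpd).trans_eq ?_
    rw [h.integral_abs_stepFn_sub hj (by omega) hpd hs, hS, ← mul_assoc, ← pow_add, ← two_mul,
      pow_mul]
    simp
  · have h1 := h.le_pointConst hn hj (by omega)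
    rw [hS, abs_mul, abs_pow, abs_neg, abs_one, one_pow, one_mul,
      abs_of_pos (envelopeB_chebNode_pos hj hj')] at h1
    exact h1

end

/-! ### The Chebyshev nodes are local maxima -/

section
open Polynomial

theorem Finset.sum_Icc_split {f : ℕ → ℝ} {k m : ℕ} (hk : 1 ≤ k) (hkm : k ≤ m) :
    ∑ i ∈ Finset.Icc 1 m, f i =
      ∑ i ∈ Finset.Ico 1 k, f i + f k + ∑ i ∈ Finset.Ioc k m, f i := by
  have e1 : Finset.Icc 1 m = Finset.Ico 1 (m + 1) := rfl
  have e2 : Finset.Ioc k m = Finset.Ico (k + 1) (m + 1) := by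
    ext i; simp only [Finset.mem_Ioc, Finset.mem_Ico]; omega
  rw [e1, e2, ← Finset.sum_Ico_consecutive f hk (by omega : k ≤ m + 1),
    Finset.sum_eq_sum_Ico_succ_bot (by omega : k < m + 1), add_assoc]

/-- The value at a Chebyshev node of the interpolating polynomial vanishing at `1`. -/
theorem eval_interpolation_right {n k : ℕ} (hk : 1 ≤ k) (hkn : k ≤ n) {p : ℝ[X]}
    (hp : p.natDegree < n) (h1 : ∀ i, 1 ≤ i → i < k → p.eval (chebNode n i) = 1)
    (h0 : ∀ i, k < i → i ≤ n + 1 → p.eval (chebNode n i) = 0) :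
    p.eval (chebNode n k) * chebNode n k =
      (chebNode n k - envelopeB n (chebNode n k)) / 2 := by
  have hw := weightedNodes_chebNode n
  -- Since `p(1) = 0`, this identity involves only `p` at the interior nodes. The values there are
  -- `1` before `k` and `0` after it, so it can be solved for `p` at node `k` through the
  -- alternating sum.
  have h2 := hw.sum_Icc_eval_div_of_eval_one p hp (by
    rw [← hw.one]; exact h0 _ (by omega) le_rfl)
  have hN : ((n : ℝ) + 1) ≠ 0 := by positivity
  have h3 : ∑ i ∈ Finset.Icc 1 n, (-1) ^ i * p.eval (chebNode n i) * chebNode n i = 0 := by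
    simp only [eval_C, mul_div_assoc', ← Finset.sum_div] at h2
    exact (div_eq_zero_iff.1 h2).resolve_right hN
  rw [Finset.sum_Icc_split hk hkn, Finset.sum_eq_zero (s := Finset.Ioc k n) fun i hi => by
    have := Finset.mem_Ioc.1 hi
    rw [h0 i this.1 (by omega)]; ring] at h3
  have h4 := alternatingSum_chebNode hk hkn
  have h5 : ∑ i ∈ Finset.Ico 1 k, (-1) ^ i * p.eval (chebNode n i) * chebNode n i =
      ∑ i ∈ Finset.Ico 1 k, (-1) ^ i * chebNode n i := by
    refine Finset.sum_congr rfl fun i hi => ?_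
    have := Finset.mem_Ico.1 hi
    rw [h1 i this.1 this.2, mul_one]
  rw [h5] at h3
  have hs : ((-1 : ℝ) ^ k) ^ 2 = 1 := by rw [← pow_mul, mul_comm, pow_mul]; simp
  linear_combination (-1) ^ k * h3 - (1 / 2) * (-1) ^ k * h4 + (-p.eval (chebNode n k) *
    chebNode n k + (1 / 2) * (chebNode n k - envelopeB n (chebNode n k))) * hs

theorem two_mul_sum_Ico_neg_one_pow {k : ℕ} (hk : 1 ≤ k) :
    2 * ∑ i ∈ Finset.Ico 1 k, (-1 : ℝ) ^ i = -1 - (-1) ^ k := by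
  obtain ⟨k, rfl⟩ : ∃ j, k = j + 1 := ⟨k - 1, by omega⟩
  have := sum_range_neg_one_pow_mul_sub (fun _ => 1) k
  simp only [sub_self, mul_zero, Finset.sum_const_zero, mul_one] at this
  linarith

/-- The value at a Chebyshev node of the interpolating polynomial equal to `1` at `0`. -/
theorem eval_interpolation_left {n k : ℕ} (hk : 1 ≤ k) (hkn : k ≤ n) {p : ℝ[X]}
    (hp : p.natDegree < n) (h1 : ∀ i, i < k → p.eval (chebNode n i) = 1)
    (h0 : ∀ i, k < i → i ≤ n → p.eval (chebNode n i) = 0) :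
    (1 - p.eval (chebNode n k)) * (1 - chebNode n k) =
      (1 - chebNode n k - envelopeB n (chebNode n k)) / 2 := by
  have hw := weightedNodes_chebNode n
  have h2 := hw.sum_Icc_eval_div_of_eval_zero (1 - p) (by
      refine (natDegree_sub_le _ _).trans_lt ?_
      rw [natDegree_one]
      omega) (by
    have := h1 0 (by omega)
    rw [hw.zero] at this
    rw [eval_sub, eval_one, this, sub_self])
  have hN : ((n : ℝ) + 1) ≠ 0 := by positivity
  have h3 : ∑ i ∈ Finset.Icc 1 n, (-1) ^ i * (1 - p.eval (chebNode n i)) * (1 - chebNode n i) =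
      0 := by
    simp only [eval_C, mul_div_assoc', ← Finset.sum_div, eval_sub, eval_one] at h2
    exact (div_eq_zero_iff.1 h2).resolve_right hN
  rw [Finset.sum_Icc_split hk hkn, Finset.sum_eq_zero (s := Finset.Ico 1 k) fun i hi => by
    have := Finset.mem_Ico.1 hi
    rw [h1 i this.2]; ring] at h3
  have h5 : ∑ i ∈ Finset.Ioc k n, (-1) ^ i * (1 - p.eval (chebNode n i)) * (1 - chebNode n i) =
      ∑ i ∈ Finset.Ioc k n, (-1) ^ i * (1 - chebNode n i) := by
    refine Finset.sum_congr rfl fun i hi => ?_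
    have := Finset.mem_Ioc.1 hi
    rw [h0 i this.1 this.2]; ring
  rw [h5] at h3
  have h4 := alternatingSum_chebNode hk hkn
  -- Exactness for `1 - X` trades the tail sum beyond `k` for the sum before `k`, whose value is
  -- known.
  have h6 := (alternatingNodes_chebNode n).sum_eq (1 - X) (by
    refine (natDegree_sub_le _ _).trans ?_
    rw [natDegree_one, natDegree_X]
    omega)
  simp only [eval_sub, eval_one, eval_X, sub_self, mul_zero, add_zero, sub_zero] at h6
  rw [Finset.sum_Icc_split hk hkn] at h6
  have h7 := two_mul_sum_Ico_neg_one_pow hk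
  have h8 : ∑ i ∈ Finset.Ico 1 k, (-1) ^ i * (1 - chebNode n i) =
      ∑ i ∈ Finset.Ico 1 k, (-1 : ℝ) ^ i - ∑ i ∈ Finset.Ico 1 k, (-1) ^ i * chebNode n i := by
    rw [← Finset.sum_sub_distrib]
    exact Finset.sum_congr rfl fun i _ => by ring
  rw [h8] at h6
  have hs : ((-1 : ℝ) ^ k) ^ 2 = 1 := by rw [← pow_mul, mul_comm, pow_mul]; simp
  have h9 : (-1 : ℝ) ^ k * ((1 - p.eval (chebNode n k)) * (1 - chebNode n k)) =
      (-1) ^ k * ((1 - chebNode n k - envelopeB n (chebNode n k)) / 2) := by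
    linear_combination h3 - (1 / 2) * h6 + (1 / 2) * h7 - (1 / 2) * h4
  exact mul_left_cancel₀ (by simp) h9

/-- The Chebyshev nodes are points of local maximum. -/
theorem isLocalMaxOn_pointConst_chebNode {n k : ℕ} (hn : 1 ≤ n) (hk : 1 ≤ k) (hkn : k ≤ n) :
    IsLocalMaxOn (pointConst n (n - 1) ⊤) (Icc 0 1) (chebNode n k) := by
  have h := alternatingNodes_chebNode n
  have hB := envelopeB_chebNode_pos hk hkn
  have hS := alternatingSum_chebNode hk hkn
  have hx := h.mem_Ioo hk hkn
  set a := chebNode n k with ha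
  obtain ⟨p, hp, hp1, hp0, hps⟩ := h.exists_interpolation (k := k) (b := 1) (d := n + 1) hn hk hkn
    le_rfl (Or.inr rfl) rfl
  obtain ⟨q, hq, hq1, hq0, hqs⟩ := h.exists_interpolation (k := k) (b := 0) (d := n) hn hk hkn
    (by omega) (Or.inl rfl) rfl
  have hpa := eval_interpolation_right hk hkn hp hp1 hp0
  have hqa := eval_interpolation_left hk hkn hq (fun i hi => hq1 i (by omega) hi) hq0
  rw [← ha] at hpa hqa
  have hpa' : p.eval a < 1 / 2 := by
    by_contra hc
    nlinarith [hx.1, not_lt.1 hc]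
  have hqa' : 1 / 2 < q.eval a := by
    by_contra hc
    nlinarith [hx.2, not_lt.1 hc]
  have hval : ∀ r : ℝ[X], r.natDegree < n → (∀ t ∈ Ioo (0 : ℝ) 1,
      0 ≤ (stepFn a t - r.eval t) * ((-1) ^ (k + 1) * (nodePoly n (chebNode n)).eval t)) →
      ∫ t in (0 : ℝ)..1, |stepFn a t - r.eval t| = envelopeB n a := by
    intro r hr hrs
    rw [h.integral_abs_stepFn_sub hk (by omega) (degree_le_natDegree.trans_lt
      (by exact_mod_cast hr)) hrs, hS, ← mul_assoc, ← pow_add, ← two_mul, pow_mul]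
    simp
  have hint : ∀ (r : ℝ[X]) (c : ℝ),
      IntervalIntegrable (fun t => |stepFn c t - r.eval t|) volume 0 1 := fun r c =>
    ((intervalIntegrable_stepFn c 0 1).sub (r.continuous.intervalIntegrable 0 1)).abs
  have hmono : ∀ (r : ℝ[X]) (b : ℝ), b ∈ Icc (0 : ℝ) 1 → r.natDegree < n →
      (∀ t ∈ Ioo (0 : ℝ) 1, 0 ≤ (stepFn a t - r.eval t) *
        ((-1) ^ (k + 1) * (nodePoly n (chebNode n)).eval t)) →
      (∀ t, |stepFn b t - r.eval t| ≤ |stepFn a t - r.eval t|) →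
      pointConst n (n - 1) ⊤ b ≤ pointConst n (n - 1) ⊤ a := by
    intro r b hb hr hrs hle
    rw [ha, pointConst_chebNode hn hk hkn, ← ha, ← hval r hr hrs]
    refine (pointConst_le_integral hn hb r (degree_le_natDegree.trans_lt
      (by exact_mod_cast hr))).trans (ENNReal.ofReal_le_ofReal ?_)
    exact intervalIntegral.integral_mono_on zero_le_one (hint r b) (hint r a) fun t _ => hle t
  have hev : ∀ᶠ t in nhds a, p.eval t < 1 / 2 ∧ 1 / 2 < q.eval t :=
    (p.continuous.continuousAt.eventually_lt continuousAt_const hpa').and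
      (continuousAt_const.eventually_lt q.continuous.continuousAt hqa')
  obtain ⟨ε, hε, hball⟩ := Metric.eventually_nhds_iff_ball.1 hev
  have : ∀ᶠ b in nhdsWithin a (Icc 0 1), b ∈ Icc (0 : ℝ) 1 ∧ b ∈ Metric.ball a ε :=
    (eventually_mem_nhdsWithin).and (nhdsWithin_le_nhds (Metric.ball_mem_nhds a hε))
  filter_upwards [this] with b hb
  have hbε := abs_lt.1 (Real.dist_eq b a ▸ Metric.mem_ball.1 hb.2)
  -- Moving the jump left turns the value `1` into `0` on `(b, a]`, which does not hurt an
  -- approximant below `1/2` there; moving it right calls for one above `1/2`.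
  rcases le_total b a with hba | hba
  · refine hmono p b hb.1 hp hps fun t => ?_
    rcases le_or_gt t b with h1 | h1
    · rw [stepFn_of_le h1, stepFn_of_le (h1.trans hba)]
    · rcases le_or_gt t a with h2 | h2
      · rw [stepFn_of_lt h1, stepFn_of_le h2]
        have h3 := (hball t (by
          rw [Metric.mem_ball, Real.dist_eq, abs_lt]; constructor <;> linarith)).1
        exact sq_le_sq.1 (by nlinarith)
      · rw [stepFn_of_lt h1, stepFn_of_lt h2]
  · refine hmono q b hb.1 hq hqs fun t => ?_
    rcases le_or_gt t a with h1 | h1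
    · rw [stepFn_of_le h1, stepFn_of_le (h1.trans hba)]
    · rcases le_or_gt t b with h2 | h2
      · rw [stepFn_of_lt h1, stepFn_of_le h2]
        have h3 := (hball t (by
          rw [Metric.mem_ball, Real.dist_eq, abs_lt]; constructor <;> linarith)).2
        exact sq_le_sq.1 (by nlinarith)
      · rw [stepFn_of_lt h1, stepFn_of_lt h2]

end

/-! ### Second-order variation: no other interior local maxima -/

section
open Polynomial

/-- Through every point of `(0, 1)` other than the Chebyshev nodes there passes a differentiable
family of systems of nodes. -/
theorem exists_nodeCurves (n : ℕ) {a : ℝ} (ha : a ∈ Ioo (0 : ℝ) 1)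
    (hne : ∀ j, 1 ≤ j → j ≤ n → a ≠ chebNode n j) :
    ∃ (k : ℕ) (s₀ : ℝ) (x : ℝ → ℕ → ℝ), 0 < s₀ ∧ 1 ≤ k ∧ k ≤ n + 1 ∧ x s₀ k = a ∧
      (∀ᶠ s in nhds s₀, WeightedNodes (n + 1) (x s) (zolotarevPoly n s) (zolotarevWeight n s)) ∧
      ∀ i, 1 ≤ i → i ≤ n + 1 → HasDerivAt (fun s => x s i)
        (-2 * (x s₀ i * (1 - x s₀ i) / (zolotarevWeight n s₀).eval (x s₀ i))) s₀ := by
  obtain ⟨s₀, k, τ, hs₀, hk, hk', hτ, hτa⟩ := exists_zolotarevAngle_sin_sq_eq n ha hne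
  have key : ∀ i : ℕ, ∃ φ : ℝ → ℝ, (i = 0 → ∀ s, φ s = 0) ∧
      (i = n + 2 → ∀ s, φ s = Real.pi / 2) ∧ (i = k → φ s₀ = τ) ∧
      (1 ≤ i → i ≤ n + 1 → (∀ᶠ s in nhds s₀, ZolotarevAngle n s i (φ s)) ∧
        HasDerivAt (fun s => Real.sin (φ s) ^ 2)
        (-2 * (Real.sin (φ s₀) ^ 2 * (1 - Real.sin (φ s₀) ^ 2) /
          (zolotarevWeight n s₀).eval (Real.sin (φ s₀) ^ 2))) s₀) := by
    intro i
    by_cases h1 : 1 ≤ i ∧ i ≤ n + 1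
    · obtain ⟨τ', hτ', hτk⟩ : ∃ τ', ZolotarevAngle n s₀ i τ' ∧ (i = k → τ' = τ) := by
        by_cases hik : i = k
        · exact ⟨τ, hik ▸ hτ, fun _ => rfl⟩
        · obtain ⟨τ', hτ'⟩ := exists_zolotarevAngle n hs₀ h1.1 h1.2
          exact ⟨τ', hτ', fun h => absurd h hik⟩
      obtain ⟨φ, h2, h3, h4⟩ := hτ'.exists_curve hs₀ h1.1 h1.2
      refine ⟨φ, by omega, by omega, fun h => by rw [h2, hτk h], fun _ _ => ⟨h3, ?_⟩⟩
      rw [h2]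
      exact h4
    -- Constant angles for the end points `0` and `1`; indices beyond `n + 2` are never used.
    · refine ⟨fun _ => if i = 0 then 0 else Real.pi / 2, fun h _ => by simp [h],
        fun h _ => by simp [h], by omega, fun h h' => absurd ⟨h, h'⟩ h1⟩
  choose φ h0 h1 h2 h3 using key
  refine ⟨k, s₀, fun s i => Real.sin (φ i s) ^ 2, hs₀, hk, hk', ?_, ?_, fun i hi hi' =>
    (h3 i hi hi').2⟩
  · show Real.sin (φ k s₀) ^ 2 = a
    rw [h2 k rfl, hτa]
  · have h4 : ∀ᶠ s in nhds s₀, ∀ i ∈ Finset.Icc 1 (n + 1), ZolotarevAngle n s i (φ i s) := by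
      rw [Filter.eventually_all_finset]
      intro i hi
      exact (h3 i (Finset.mem_Icc.1 hi).1 (Finset.mem_Icc.1 hi).2).1
    filter_upwards [h4, eventually_gt_nhds hs₀] with s hs hs'
    exact weightedNodes_zolotarev n hs' (τ := fun i => φ i s) (h0 0 rfl s) (h1 _ rfl s)
      fun i hi hi' => hs i (Finset.mem_Icc.2 ⟨hi, hi'⟩)

/-- Second order expansion of a polynomial along a curve through a critical point. -/
theorem tendsto_eval_sub_div_sq {R : ℝ[X]} {f : ℝ → ℝ} {f' s₀ : ℝ} (hf : HasDerivAt f f' s₀)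
    (hR : R.derivative.eval (f s₀) = 0) :
    Filter.Tendsto (fun s => (R.eval (f s) - R.eval (f s₀)) / (s - s₀) ^ 2)
      (nhdsWithin s₀ {s₀}ᶜ) (nhds (R.derivative.derivative.eval (f s₀) / 2 * f' ^ 2)) := by
  obtain ⟨R1, h1⟩ : X - C (f s₀) ∣ R - C (R.eval (f s₀)) := X_sub_C_dvd_sub_C_eval
  have e1 : R = (X - C (f s₀)) * R1 + C (R.eval (f s₀)) := by rw [← h1]; ring
  have e2 : R.derivative = R1 + (X - C (f s₀)) * R1.derivative := by
    conv_lhs => rw [e1]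
    simp
  have h2 : R1.eval (f s₀) = 0 := by
    rw [e2] at hR
    simpa using hR
  obtain ⟨K, rfl⟩ := dvd_iff_isRoot.2 h2
  have e3 : R.derivative.derivative.eval (f s₀) / 2 = K.eval (f s₀) := by
    rw [e2]
    simp
  have h3 := hasDerivAt_iff_tendsto_slope.1 hf
  have h4 : Filter.Tendsto (fun s => K.eval (f s)) (nhdsWithin s₀ {s₀}ᶜ)
      (nhds (K.eval (f s₀))) :=
    (K.continuous.continuousAt.comp hf.continuousAt).tendsto.mono_left nhdsWithin_le_nhds
  rw [e3]
  refine (h4.mul (h3.pow 2)).congr' ?_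
  filter_upwards [self_mem_nhdsWithin] with s hs
  have hs' : s - s₀ ≠ 0 := sub_ne_zero.2 hs
  have e4 : R.eval (f s) - R.eval (f s₀) = (f s - f s₀) ^ 2 * K.eval (f s) := by
    conv_lhs => rw [e1]
    simp only [eval_add, eval_mul, eval_sub, eval_X, eval_C]
    ring
  rw [e4, slope_def_field]
  field_simp

/-- The signs of the derivative of the interpolating polynomial at the nodes. -/
theorem AlternatingNodes.derivative_interpolation_sign {n m k : ℕ} {x : ℕ → ℝ}
    (h : AlternatingNodes n m x) (hk : k ≤ m) {p : ℝ[X]}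
    (h1 : ∀ i, 1 ≤ i → i < k → p.eval (x i) = 1) (h0 : ∀ i, k < i → i ≤ m → p.eval (x i) = 0)
    (hs : ∀ t ∈ Ioo (0 : ℝ) 1,
      0 ≤ (stepFn (x k) t - p.eval t) * ((-1) ^ (k + 1) * (nodePoly m x).eval t))
    {i : ℕ} (hi : 1 ≤ i) (hi' : i ≤ m) (hik : i ≠ k) :
    0 ≤ (-1) ^ (i + k) * p.derivative.eval (x i) := by
  have hlt := h.lt_succ i hi'
  -- For `i ≠ k` the step function keeps the value `p (x i)` just to the right of `x i`, so the
  -- known sign of the error is the sign of the increment of `p`.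
  have h2 : ∀ t ∈ Ioo (x i) (x (i + 1)), 0 ≤ (-1) ^ (i + k) * (p.eval t - p.eval (x i)) := by
    intro t ht
    have h3 : stepFn (x k) t = p.eval (x i) := by
      rcases lt_or_gt_of_ne hik with h' | h'
      · rw [h1 i hi h', stepFn_of_le (ht.2.le.trans (h.le h' (by omega)))]
      · rw [h0 i h' hi', stepFn_of_lt ((h.lt h' (by omega)).trans ht.1)]
    have h4 := hs t ⟨(h.mem_Ioo hi hi').1.trans ht.1,
      ht.2.trans_le (h.mem_Icc (by omega)).2⟩
    have h5 := h.nodePoly_sign hi' ht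
    rw [h3] at h4
    have h6 : (p.eval (x i) - p.eval t) * ((-1) ^ (k + 1) * (nodePoly m x).eval t) =
        ((-1) ^ i * (nodePoly m x).eval t) * ((-1) ^ (i + k) * (p.eval t - p.eval (x i))) := by
      have : ((-1 : ℝ) ^ i) ^ 2 = 1 := by rw [← pow_mul, mul_comm, pow_mul]; simp
      rw [pow_succ, pow_add]
      linear_combination (nodePoly m x).eval t * (-1) ^ k * (p.eval (x i) - p.eval t) * this
    rw [h6] at h4
    exact nonneg_of_mul_nonneg_right h4 h5
  have h7 : HasDerivWithinAt (fun t => (-1) ^ (i + k) * (p.eval t - p.eval (x i)))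
      ((-1) ^ (i + k) * p.derivative.eval (x i)) (Ioi (x i)) (x i) :=
    (((p.hasDerivAt (x i)).sub_const _).const_mul _).hasDerivWithinAt
  rw [hasDerivWithinAt_iff_tendsto_slope' (by simp)] at h7
  refine ge_of_tendsto h7 ?_
  filter_upwards [Ioo_mem_nhdsGT hlt] with t ht
  rw [slope_def_field]
  simp only [sub_self, mul_zero, sub_zero]
  exact div_nonneg (h2 t ht) (sub_nonneg.2 ht.1.le)

/-- A consequence of the concavity of the weight `x (1 - x) / l(x)`. -/
theorem sum_derivative_mul_weight_sq_pos {n k : ℕ} {s : ℝ} (hs0 : 0 < s) {x : ℕ → ℝ}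
    (hw : WeightedNodes (n + 1) x (zolotarevPoly n s) (zolotarevWeight n s)) (hk : 1 ≤ k)
    (hk' : k ≤ n + 1) {p : ℝ[X]} (hp : p.natDegree < n) (hp0 : p.natDegree ≠ 0)
    (hsign : ∀ i, 1 ≤ i → i ≤ n + 1 → i ≠ k → 0 ≤ (-1) ^ (i + k) * p.derivative.eval (x i)) :
    0 < ∑ i ∈ Finset.Icc 1 (n + 1), -((-1) ^ (i + k) * p.derivative.eval (x i)) *
      (x i * (1 - x i) / (zolotarevWeight n s).eval (x i)) ^ 2 := by
  set L := zolotarevWeight n s with hL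
  set w : ℕ → ℝ := fun i => x i * (1 - x i) / L.eval (x i) with hwdef
  have hwpos : ∀ i, 1 ≤ i → i ≤ n + 1 → 0 < w i := fun i hi hi' =>
    div_pos (mul_pos (hw.pos hi hi') (sub_pos.2 (hw.lt_one hi'))) (hw.weight_pos_node hi hi')
  have hpd := natDegree_derivative_lt hp0
  -- The derivative of `p` has degree at most `n - 2`, so the quadrature still allows multiplication
  -- by a linear factor.
  have hlin : ∀ u v : ℝ, ∑ i ∈ Finset.Icc 1 (n + 1),
      -((-1) ^ (i + k) * p.derivative.eval (x i)) * w i * (u * x i + v) = 0 := by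
    intro u v
    have h1 := hw.sum_Icc_eval_div (p.derivative * (C u * X + C v)) (by
      have := natDegree_mul_le (p := p.derivative) (q := C u * X + C v)
      have := natDegree_linear_le (a := u) (b := v)
      omega)
    have h2 : ∑ i ∈ Finset.Icc 1 (n + 1),
        -((-1) ^ (i + k) * p.derivative.eval (x i)) * w i * (u * x i + v) =
        -(-1) ^ k * ∑ i ∈ Finset.Icc 1 (n + 1), (-1) ^ i *
          (p.derivative * (C u * X + C v)).eval (x i) * (x i * (1 - x i) / L.eval (x i)) := by
      rw [Finset.mul_sum]
      refine Finset.sum_congr rfl fun i _ => ?_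
      simp only [hwdef, eval_mul, eval_add, eval_C, eval_X]
      rw [pow_add]
      ring
    rw [h2, h1, mul_zero]
  set b := x k with hb
  have hbL : 0 < L.eval b := hw.weight_pos_node hk hk'
  set l0 : ℝ := (n : ℝ) + 1 + s with hl0
  set l1 : ℝ := ((n : ℝ) + 1) * s ^ 2 + s with hl1
  have hl0p : 0 < l0 := by positivity
  have hl1p : 0 < l1 := by positivity
  -- The line `u X + v` is the tangent at `b` to the concave function `x (1 - x) / L(x)`.
  -- Subtracting it leaves the sum unchanged, kills the term `k`, whose sign is unknown, and makes
  -- every other term nonnegative.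
  set u : ℝ := (l0 * (1 - b) ^ 2 - l1 * b ^ 2) / L.eval b ^ 2 with hu
  set v : ℝ := l1 * b ^ 2 / L.eval b ^ 2 with hv
  have hdiff : ∀ i, 1 ≤ i → i ≤ n + 1 →
      w i - (u * x i + v) = -(l0 * l1 * (x i - b) ^ 2 / (L.eval b ^ 2 * L.eval (x i))) := by
    intro i hi hi'
    have hLi : 0 < L.eval (x i) := hw.weight_pos_node hi hi'
    have e1 : L.eval (x i) = l0 * (1 - x i) + l1 * x i := eval_zolotarevWeight n s (x i)
    have e2 : L.eval b = l0 * (1 - b) + l1 * b := eval_zolotarevWeight n s b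
    have e3 : u * x i + v = (l0 * (1 - b) ^ 2 * x i + l1 * b ^ 2 * (1 - x i)) / L.eval b ^ 2 := by
      rw [hu, hv]; ring
    rw [e3, ← neg_div, div_sub_div _ _ hLi.ne' (pow_pos hbL 2).ne',
      div_eq_div_iff (by positivity) (by positivity)]
    rw [e1, e2]
    clear_value l0 l1 b
    ring
  have hterm : ∀ i ∈ Finset.Icc 1 (n + 1),
      0 ≤ -((-1) ^ (i + k) * p.derivative.eval (x i)) * w i * (w i - (u * x i + v)) := by
    intro i hi
    obtain ⟨hi, hi'⟩ := Finset.mem_Icc.1 hi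
    have hLi : 0 < L.eval (x i) := hw.weight_pos_node hi hi'
    rw [hdiff i hi hi']
    by_cases hik : i = k
    · subst hik
      simp [hb]
    · have h1 := mul_nonneg (hsign i hi hi' hik) (hwpos i hi hi').le
      have h2 : 0 ≤ l0 * l1 * (x i - b) ^ 2 / (L.eval b ^ 2 * L.eval (x i)) := by positivity
      have := mul_nonneg h1 h2
      linarith
  have hsum : ∑ i ∈ Finset.Icc 1 (n + 1), -((-1) ^ (i + k) * p.derivative.eval (x i)) * w i ^ 2 =
      ∑ i ∈ Finset.Icc 1 (n + 1),
        -((-1) ^ (i + k) * p.derivative.eval (x i)) * w i * (w i - (u * x i + v)) := by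
    rw [← sub_zero (∑ i ∈ Finset.Icc 1 (n + 1), _ * w i ^ 2), ← hlin u v,
      ← Finset.sum_sub_distrib]
    exact Finset.sum_congr rfl fun i _ => by ring
  rw [hsum]
  refine lt_of_le_of_ne (Finset.sum_nonneg hterm) fun h0 => ?_
  -- Equality would force the derivative of `p` to vanish at every node but `k`, hence by `hlin 0 1`
  -- also at `k`, which is too many roots.
  have hz := (Finset.sum_eq_zero_iff_of_nonneg hterm).1 h0.symm
  have hd0 : ∀ i, 1 ≤ i → i ≤ n + 1 → i ≠ k → p.derivative.eval (x i) = 0 := by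
    intro i hi hi' hik
    have h1 := hz i (Finset.mem_Icc.2 ⟨hi, hi'⟩)
    have hLi : 0 < L.eval (x i) := hw.weight_pos_node hi hi'
    have hne : x i - b ≠ 0 := by
      rw [sub_ne_zero, hb]
      exact fun e => hik (hw.injOn (Set.mem_Iic.2 (by omega)) (Set.mem_Iic.2 (by omega)) e)
    rw [hdiff i hi hi'] at h1
    have h2 : -(l0 * l1 * (x i - b) ^ 2 / (L.eval b ^ 2 * L.eval (x i))) ≠ 0 := by
      rw [neg_ne_zero]; positivity
    have h3 := (mul_eq_zero.1 ((mul_eq_zero.1 h1).resolve_right h2)).resolve_right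
      (hwpos i hi hi').ne'
    rw [neg_eq_zero] at h3
    exact (mul_eq_zero.1 h3).resolve_left (by simp)
  have hdk : p.derivative.eval (x k) = 0 := by
    have h1 := hlin 0 1
    rw [Finset.sum_eq_single k] at h1
    · simp only [zero_mul, zero_add, mul_one] at h1
      have h3 := (mul_eq_zero.1 h1).resolve_right (hwpos k hk hk').ne'
      rw [neg_eq_zero] at h3
      exact (mul_eq_zero.1 h3).resolve_left (by simp)
    · intro i hi hik
      obtain ⟨hi, hi'⟩ := Finset.mem_Icc.1 hi
      rw [hd0 i hi hi' hik]
      ring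
    · intro h
      exact absurd (Finset.mem_Icc.2 ⟨hk, hk'⟩) h
  have hall : ∀ i ∈ Finset.Icc 1 (n + 1), p.derivative.eval (x i) = 0 := by
    intro i hi
    obtain ⟨hi, hi'⟩ := Finset.mem_Icc.1 hi
    by_cases hik : i = k
    · rw [hik, hdk]
    · exact hd0 i hi hi' hik
  have hzero : p.derivative = 0 := by
    have hinj : Set.InjOn x (Finset.Icc 1 (n + 1)) := hw.injOn.mono fun i hi => by
      have := (Finset.mem_Icc.1 hi).2
      exact Set.mem_Iic.2 (by omega)
    refine eq_zero_of_degree_lt_of_eval_index_eq_zero _ hinj ?_ hall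
    · rw [Nat.card_Icc]
      refine degree_le_natDegree.trans_lt ?_
      exact_mod_cast (by omega : p.derivative.natDegree < n + 1 + 1 - 1)
  exact hp0 (derivative_eq_zero.1 hzero)

end

section
open Polynomial

theorem WeightedNodes.alternatingNodes_zolotarev {n : ℕ} {s : ℝ} {x : ℕ → ℝ}
    (hw : WeightedNodes (n + 1) x (zolotarevPoly n s) (zolotarevWeight n s)) :
    AlternatingNodes n (n + 1) x :=
  hw.alternatingNodes (by have := natDegree_zolotarevWeight_le n s; omega)

/-- A point of `(0, 1)` that is not a Chebyshev node is not a point of local maximum. -/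
theorem not_isLocalMaxOn_pointConst {n : ℕ} (hn : 1 ≤ n) {a : ℝ} (ha : a ∈ Ioo (0 : ℝ) 1)
    (hne : ∀ j, 1 ≤ j → j ≤ n → a ≠ chebNode n j) :
    ¬IsLocalMaxOn (pointConst n (n - 1) ⊤) (Icc 0 1) a := by
  intro hmax
  obtain ⟨k, s₀, x, hs₀, hk, hk', hxa, hw, hder⟩ := exists_nodeCurves n ha hne
  have hw0 := hw.self_of_nhds
  have h0 := hw0.alternatingNodes_zolotarev
  obtain ⟨p, hp, hp1, hp0, hps⟩ := h0.exists_interpolation (k := k) (b := 1) (d := n + 1) hn hk hk'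
    le_rfl (Or.inl rfl) rfl
  have hpd : p.degree < n := degree_le_natDegree.trans_lt (by exact_mod_cast hp)
  obtain ⟨P, hP, hPd, hP0⟩ := p.exists_derivative_eq hpd
  have hPn : P.natDegree ≤ n := by
    by_cases h : P = 0
    · simp [h]
    · exact Nat.lt_succ_iff.1 ((natDegree_lt_iff_degree_lt h).2 hPd)
  let T : ℝ → ℝ := fun s => 2 * ∑ i ∈ Finset.Ico 1 k, (-1) ^ i * x s i + (-1) ^ k * x s k
  have hval : ∫ t in (0 : ℝ)..1, |stepFn a t - p.eval t| = (-1) ^ k * T s₀ := by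
    rw [← hxa]
    exact h0.integral_abs_stepFn_sub hk (by omega) hpd hps
  have hnonneg : 0 ≤ (-1) ^ k * T s₀ := by
    rw [← hval]
    exact intervalIntegral.integral_nonneg zero_le_one fun t _ => abs_nonneg _
  have hAa : pointConst n (n - 1) ⊤ a ≤ ENNReal.ofReal ((-1) ^ k * T s₀) := by
    rw [← hval]
    exact pointConst_le_integral hn ⟨ha.1.le, ha.2.le⟩ p hpd
  have hcont : ContinuousAt (fun s => x s k) s₀ := (hder k hk hk').continuousAt
  -- Along the family the alternating sum bounds `A` from below at the moving node, and at `s₀` it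
  -- also bounds `A` from above; a local maximum of `A` thus passes to the sum.
  have hTle : ∀ᶠ s in nhds s₀, (-1) ^ k * T s ≤ (-1) ^ k * T s₀ := by
    have h1 : ∀ᶠ s in nhds s₀,
        pointConst n (n - 1) ⊤ (x s k) ≤ pointConst n (n - 1) ⊤ a := by
      have h2 : ∀ᶠ b in nhds (x s₀ k), b ∈ Icc (0 : ℝ) 1 →
          pointConst n (n - 1) ⊤ b ≤ pointConst n (n - 1) ⊤ a := by
        rw [hxa]
        exact eventually_nhdsWithin_iff.1 hmax
      filter_upwards [hcont.eventually h2, hw] with s hs hws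
      exact hs (hws.alternatingNodes_zolotarev.mem_Icc (by omega))
    filter_upwards [h1, hw] with s hs hws
    have h3 := hws.alternatingNodes_zolotarev.le_pointConst hn hk (by omega)
    have h4 := (h3.trans hs).trans hAa
    rw [ENNReal.ofReal_le_ofReal_iff hnonneg] at h4
    refine le_trans ?_ h4
    refine (le_abs_self _).trans_eq ?_
    rw [abs_mul, abs_pow, abs_neg, abs_one, one_pow, one_mul]
  let e : ℕ → ℝ := fun i => if i < k then 2 * (-1) ^ i else if i = k then (-1) ^ k else 0
  -- Twice the alternating sum of `P`, an antiderivative of `p`, over the nodes is constant along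
  -- the family. Subtracting it makes each node with `i ≠ k` a critical point of its summand, so
  -- second derivatives of the curves never enter.
  let R : ℕ → ℝ[X] := fun i => C ((-1) ^ k) * (C (e i) * X - C (2 * (-1) ^ i) * P)
  have hT : ∀ᶠ s in nhds s₀, (-1) ^ k * T s =
      ∑ i ∈ Finset.Icc 1 (n + 1), (R i).eval (x s i) -
        (-1) ^ k * ((-1) ^ (n + 1 + 1) * P.eval 1) := by
    filter_upwards [hw] with s hws
    have h1 := hws.alternatingNodes_zolotarev.sum_eq P hPn
    rw [hP0, zero_add] at h1
    have h2 : ∑ i ∈ Finset.Icc 1 (n + 1), e i * x s i = T s := by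
      rw [Finset.sum_Icc_split hk hk', Finset.sum_eq_zero (s := Finset.Ioc k (n + 1)) fun i hi => by
        have := Finset.mem_Ioc.1 hi
        simp only [e]
        rw [if_neg (by omega), if_neg (by omega), zero_mul], add_zero]
      simp only [T, e, lt_irrefl, if_false, if_true]
      congr 1
      rw [Finset.mul_sum]
      refine Finset.sum_congr rfl fun i hi => ?_
      rw [if_pos (Finset.mem_Ico.1 hi).2]
      ring
    have h3 : ∑ i ∈ Finset.Icc 1 (n + 1), (R i).eval (x s i) =
        (-1) ^ k * (∑ i ∈ Finset.Icc 1 (n + 1), e i * x s i -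
          2 * ∑ i ∈ Finset.Icc 1 (n + 1), (-1) ^ i * P.eval (x s i)) := by
      rw [Finset.mul_sum, ← Finset.sum_sub_distrib, Finset.mul_sum]
      refine Finset.sum_congr rfl fun i _ => ?_
      simp only [R, eval_mul, eval_sub, eval_C, eval_X]
      ring
    rw [h3, h2]
    linear_combination (-1) ^ k * h1
  have hR1 : ∀ i, (R i).derivative.eval (x s₀ i) =
      (-1) ^ k * (e i - 2 * (-1) ^ i * p.eval (x s₀ i)) := by
    intro i
    simp only [R, derivative_mul, derivative_sub, derivative_C, derivative_X, hP, eval_mul,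
      eval_sub, eval_add, eval_C, eval_X, Polynomial.eval_zero, Polynomial.eval_one]
    ring
  have hR2 : ∀ i, (R i).derivative.derivative.eval (x s₀ i) =
      -2 * ((-1) ^ (i + k) * p.derivative.eval (x s₀ i)) := by
    intro i
    simp only [R, derivative_mul, derivative_sub, derivative_C, derivative_X, hP, eval_mul,
      eval_sub, eval_C, Polynomial.eval_zero, zero_mul, zero_add, mul_one]
    ring
  have hRi : ∀ i, 1 ≤ i → i ≤ n + 1 → i ≠ k → (R i).derivative.eval (x s₀ i) = 0 := by
    intro i hi hi' hik
    rw [hR1]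
    rcases lt_or_gt_of_ne hik with h | h
    · simp only [e, if_pos h, hp1 i hi h]
      ring
    · simp only [e, if_neg (not_lt.2 h.le), if_neg hik, hp0 i h hi']
      ring
  let w : ℕ → ℝ := fun i => x s₀ i * (1 - x s₀ i) / (zolotarevWeight n s₀).eval (x s₀ i)
  have hwk : 0 < w k :=
    div_pos (mul_pos (hw0.pos hk hk') (sub_pos.2 (hw0.lt_one hk'))) (hw0.weight_pos_node hk hk')
  have hGle : ∀ᶠ s in nhds s₀, ∑ i ∈ Finset.Icc 1 (n + 1), (R i).eval (x s i) ≤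
      ∑ i ∈ Finset.Icc 1 (n + 1), (R i).eval (x s₀ i) := by
    filter_upwards [hTle, hT] with s h1 h2
    have h3 := hT.self_of_nhds
    linarith
  have hGder : HasDerivAt (fun s => ∑ i ∈ Finset.Icc 1 (n + 1), (R i).eval (x s i))
      (∑ i ∈ Finset.Icc 1 (n + 1), (R i).derivative.eval (x s₀ i) * (-2 * w i)) s₀ := by
    refine HasDerivAt.fun_sum fun i hi => ?_
    obtain ⟨hi, hi'⟩ := Finset.mem_Icc.1 hi
    exact ((R i).hasDerivAt (x s₀ i)).comp s₀ (hder i hi hi')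
  -- Only the term `k` survives in the first derivative, and its vanishing says `p(a) = 1/2`. In
  -- particular `p` is not constant, since its other prescribed values are `0` and `1`.
  have hzero := IsLocalMax.hasDerivAt_eq_zero (show IsLocalMax _ s₀ from hGle) hGder
  rw [Finset.sum_eq_single k (fun i hi hik => by
      obtain ⟨hi, hi'⟩ := Finset.mem_Icc.1 hi
      rw [hRi i hi hi' hik, zero_mul])
    (fun h => absurd (Finset.mem_Icc.2 ⟨hk, hk'⟩) h)] at hzero
  have hRk : (R k).derivative.eval (x s₀ k) = 0 :=
    (mul_eq_zero.1 hzero).resolve_right (by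
      have := hwk.ne'
      simp [this])
  have hpa : p.eval (x s₀ k) = 1 / 2 := by
    rw [hR1] at hRk
    have h1 := (mul_eq_zero.1 hRk).resolve_left (by simp)
    simp only [e, lt_irrefl, if_false, if_true] at h1
    have h2 : (-1 : ℝ) ^ k * (1 - 2 * p.eval (x s₀ k)) = 0 := by linarith
    have h3 := (mul_eq_zero.1 h2).resolve_left (by simp)
    linarith
  have hpdeg : p.natDegree ≠ 0 := by
    intro h
    rw [natDegree_eq_zero] at h
    obtain ⟨c, rfl⟩ := h
    rw [eval_C] at hpa
    by_cases hk1 : k = 1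
    · have := hp0 (n + 1) (by omega) le_rfl
      rw [eval_C] at this
      rw [this] at hpa
      norm_num at hpa
    · have := hp1 1 le_rfl (by omega)
      rw [eval_C] at this
      rw [this] at hpa
      norm_num at hpa
  have hpos := sum_derivative_mul_weight_sq_pos hs₀ hw0 hk hk' hp hpdeg
    fun i hi hi' hik => h0.derivative_interpolation_sign hk' hp1 hp0 hps hi hi' hik
  have hlim : Filter.Tendsto (fun s => ∑ i ∈ Finset.Icc 1 (n + 1),
      ((R i).eval (x s i) - (R i).eval (x s₀ i)) / (s - s₀) ^ 2) (nhdsWithin s₀ {s₀}ᶜ)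
      (nhds (∑ i ∈ Finset.Icc 1 (n + 1),
        (R i).derivative.derivative.eval (x s₀ i) / 2 * (-2 * w i) ^ 2)) := by
    refine tendsto_finsetSum _ fun i hi => ?_
    obtain ⟨hi, hi'⟩ := Finset.mem_Icc.1 hi
    refine tendsto_eval_sub_div_sq (hder i hi hi') ?_
    by_cases hik : i = k
    · rw [hik]; exact hRk
    · exact hRi i hi hi' hik
  have hle : ∑ i ∈ Finset.Icc 1 (n + 1),
      (R i).derivative.derivative.eval (x s₀ i) / 2 * (-2 * w i) ^ 2 ≤ 0 := by
    refine le_of_tendsto hlim ?_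
    filter_upwards [nhdsWithin_le_nhds hGle] with s hs
    rw [← Finset.sum_div, Finset.sum_sub_distrib]
    exact div_nonpos_of_nonpos_of_nonneg (sub_nonpos.2 hs) (sq_nonneg _)
  have heq : ∑ i ∈ Finset.Icc 1 (n + 1),
      (R i).derivative.derivative.eval (x s₀ i) / 2 * (-2 * w i) ^ 2 =
      4 * ∑ i ∈ Finset.Icc 1 (n + 1), -((-1) ^ (i + k) * p.derivative.eval (x s₀ i)) *
        (x s₀ i * (1 - x s₀ i) / (zolotarevWeight n s₀).eval (x s₀ i)) ^ 2 := by
    rw [Finset.mul_sum]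
    refine Finset.sum_congr rfl fun i _ => ?_
    rw [hR2]
    simp only [w]
    ring
  rw [heq] at hle
  linarith

end

/-! ### The set of local maxima -/

theorem pointConst_eq_zero {n k : ℕ} {p : ℝ≥0∞} (hk : k < n) {e : ℝ} (he : e = 0 ∨ e = 1) :
    pointConst n k p e = 0 := by
  refine le_antisymm (sInf_le fun y hy => ?_) zero_le
  have : segDeriv k y e = 0 := by
    rcases he with rfl | rfl
    · exact hy.left_eq_zero k hk
    · exact hy.right_eq_zero k hk
  simp [this]

theorem AlternatingNodes.integral_signFn_eq {n m : ℕ} {x : ℕ → ℝ} (h : AlternatingNodes n m x)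
    {j : ℕ} (hj : j ≤ m) {u v : ℝ} (hu : x j ≤ u) (huv : u ≤ v) (hv : v ≤ x (j + 1)) :
    ∫ t in u..v, signFn (nodePoly m x) t = (-1) ^ j * (v - u) := by
  have : ∫ t in u..v, signFn (nodePoly m x) t = ∫ t in u..v, (-1 : ℝ) ^ j := by
    refine intervalIntegral.integral_congr_ae (ae_mem_uIoc_imp_of_Ioo huv fun t ht => ?_)
    exact h.signFn_eq hj ⟨hu.trans_lt ht.1, ht.2.trans_le hv⟩
  rw [this, intervalIntegral.integral_const, smul_eq_mul, mul_comm]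

/-- `A_{n,n-1,∞}` is positive at the interior points near `0` and near `1`. -/
theorem pointConst_pos {n : ℕ} (hn : 1 ≤ n) {b : ℝ} (hb : b ∈ Ioo (0 : ℝ) 1)
    (h : b ≤ chebNode n 1 ∨ chebNode n n ≤ b) : 0 < pointConst n (n - 1) ⊤ b := by
  have hx := alternatingNodes_chebNode n
  refine lt_of_lt_of_le ?_ (ofReal_abs_integral_signFn_le_pointConst
    (nodePoly_ne_zero n (chebNode n)) hn hx.orthogonal ⟨hb.1.le, hb.2.le⟩)
  rw [ENNReal.ofReal_pos, abs_pos]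
  rcases h with h | h
  · rw [hx.integral_signFn_eq (Nat.zero_le n) hx.zero.le hb.1.le h]
    simpa using hb.1.ne'
  · have h1 := intervalIntegral.integral_add_adjacent_intervals
      (intervalIntegrable_signFn (nodePoly n (chebNode n)) 0 b)
      (intervalIntegrable_signFn (nodePoly n (chebNode n)) b 1)
    have h2 := hx.orthogonal 1 (by
      rw [Polynomial.degree_one]; exact_mod_cast hn)
    simp only [Polynomial.eval_one, mul_one] at h2
    rw [h2, hx.integral_signFn_eq le_rfl h hb.2.le hx.one.ge] at h1
    intro h3
    rw [h3, zero_add] at h1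
    refine (sub_pos.2 hb.2).ne' ((mul_eq_zero.1 h1).resolve_left (by simp))

/-- The end points are excluded because the function is zero there and positive at nearby interior
points. -/
theorem localMaxPoints_pointConst {n : ℕ} (hn : 1 ≤ n) :
    localMaxPoints (pointConst n (n - 1) ⊤) = {a | ∃ j, 1 ≤ j ∧ j ≤ n ∧ a = chebNode n j} := by
  have hx := alternatingNodes_chebNode n
  ext a
  constructor
  · rintro ⟨ha, hmax⟩
    have hend : ∀ l : Filter ℝ, l.NeBot → l ≤ nhdsWithin a (Icc 0 1) →
        (∀ᶠ b in l, b ∈ Ioo (0 : ℝ) 1 ∧ (b ≤ chebNode n 1 ∨ chebNode n n ≤ b)) →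
        ¬(a = 0 ∨ a = 1) := by
      intro l _ hl hev hae
      obtain ⟨b, hb, hb'⟩ := (hev.and (hl hmax)).exists
      have hb' : pointConst n (n - 1) ⊤ b ≤ pointConst n (n - 1) ⊤ a := hb'
      rw [pointConst_eq_zero (by omega) hae] at hb'
      exact (pointConst_pos hn hb.1 hb.2).not_ge hb'
    by_contra hne
    simp only [mem_ofPred_eq, not_exists, not_and] at hne
    rcases ha.1.eq_or_lt with rfl | h0
    · refine hend (nhdsWithin 0 (Ioi 0)) inferInstance ?_ ?_ (Or.inl rfl)
      · rw [← nhdsWithin_Ioc_eq_nhdsGT (zero_lt_one' ℝ)]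
        exact nhdsWithin_mono _ Ioc_subset_Icc_self
      · have h1 := hx.mem_Ioo le_rfl hn
        filter_upwards [Ioo_mem_nhdsGT h1.1] with b hb
        exact ⟨⟨hb.1, hb.2.trans h1.2⟩, Or.inl hb.2.le⟩
    rcases ha.2.eq_or_lt with rfl | h1
    · refine hend (nhdsWithin 1 (Iio 1)) inferInstance ?_ ?_ (Or.inr rfl)
      · rw [← nhdsWithin_Ico_eq_nhdsLT (zero_lt_one' ℝ)]
        exact nhdsWithin_mono _ Ico_subset_Icc_self
      · have h1 := hx.mem_Ioo hn le_rfl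
        filter_upwards [Ioo_mem_nhdsLT h1.2] with b hb
        exact ⟨⟨h1.1.trans hb.1, hb.2⟩, Or.inr hb.1.le⟩
    exact not_isLocalMaxOn_pointConst hn ⟨h0, h1⟩ hne hmax
  · rintro ⟨j, hj, hj', rfl⟩
    exact ⟨hx.mem_Icc (by omega), isLocalMaxOn_pointConst_chebNode hn hj hj'⟩

/-! ### Global maxima -/

theorem exists_isMaxOn_pointConst {n : ℕ} (hn : 1 ≤ n) :
    ∃ a ∈ Icc (0 : ℝ) 1, IsMaxOn (pointConst n (n - 1) ⊤) (Icc 0 1) a := by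
  refine UpperSemicontinuousOn.exists_isMaxOn (nonempty_Icc.2 zero_le_one) isCompact_Icc ?_
  intro a ha c hc
  have hlim : Filter.Tendsto (fun b => pointConst n (n - 1) ⊤ a + ENNReal.ofReal |b - a|)
      (nhdsWithin a (Icc 0 1)) (nhds (pointConst n (n - 1) ⊤ a)) := by
    have : Continuous fun b => pointConst n (n - 1) ⊤ a + ENNReal.ofReal |b - a| :=
      continuous_const.add (ENNReal.continuous_ofReal.comp (by fun_prop))
    simpa using (this.tendsto a).mono_left nhdsWithin_le_nhds
  filter_upwards [hlim.eventually (gt_mem_nhds hc), self_mem_nhdsWithin] with b hb hb'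
  exact (pointConst_le_add hn hb' ha).trans_lt hb

theorem envelopeB_le_envelopeB {n : ℕ} (hn : 1 ≤ n) {a b : ℝ} (hb : b ∈ Icc (0 : ℝ) 1) :
    envelopeB n a ≤ envelopeB n b ↔ |b - 1 / 2| ≤ |a - 1 / 2| := by
  rw [envelopeB, envelopeB, mul_le_mul_iff_right₀ (tan_pi_div_pos hn),
    Real.sqrt_le_sqrt_iff (by nlinarith [hb.1, hb.2]), ← sq_le_sq]
  constructor <;> intro h <;> linarith

/-- A global maximum exists and is a local one, so it suffices to compare values of `B_n` at the
local maxima, and these are ordered by distance to `1/2`. -/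
theorem globalMaxPoints_pointConst {n : ℕ} (hn : 1 ≤ n) :
    globalMaxPoints (pointConst n (n - 1) ⊤) =
      {a | a ∈ localMaxPoints (pointConst n (n - 1) ⊤) ∧
        ∀ b ∈ localMaxPoints (pointConst n (n - 1) ⊤), |a - 1 / 2| ≤ |b - 1 / 2|} := by
  have key : ∀ a ∈ localMaxPoints (pointConst n (n - 1) ⊤),
      ∀ b ∈ localMaxPoints (pointConst n (n - 1) ⊤),
        pointConst n (n - 1) ⊤ b ≤ pointConst n (n - 1) ⊤ a ↔ |a - 1 / 2| ≤ |b - 1 / 2| := by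
    intro a ha b hb
    rw [← envelopeB_le_envelopeB hn ha.1]
    rw [localMaxPoints_pointConst hn] at ha hb
    obtain ⟨i, hi, hi', rfl⟩ := ha
    obtain ⟨j, hj, hj', rfl⟩ := hb
    rw [pointConst_chebNode hn hi hi', pointConst_chebNode hn hj hj',
      ENNReal.ofReal_le_ofReal_iff (envelopeB_chebNode_pos hi hi').le]
  ext a
  constructor
  · rintro ⟨ha, hmax⟩
    have hloc : a ∈ localMaxPoints (pointConst n (n - 1) ⊤) := ⟨ha, hmax.localize⟩
    exact ⟨hloc, fun b hb => (key a hloc b hb).1 (hmax hb.1)⟩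
  · rintro ⟨ha, hnear⟩
    obtain ⟨c, hc, hmax⟩ := exists_isMaxOn_pointConst hn
    have hloc : c ∈ localMaxPoints (pointConst n (n - 1) ⊤) := ⟨hc, hmax.localize⟩
    exact ⟨ha.1, fun b hb => (hmax hb).trans ((key a ha c hloc).2 (hnear c hloc))⟩

theorem chebNode_add_chebNode {n i j : ℕ} (hij : i + j = n + 1) :
    chebNode n i + chebNode n j = 1 := by
  have e : Real.pi * (j : ℝ) / (2 * ((n : ℝ) + 1)) =
      Real.pi / 2 - Real.pi * (i : ℝ) / (2 * ((n : ℝ) + 1)) := by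
    have : (i : ℝ) + j = n + 1 := by exact_mod_cast hij
    have hn : (n : ℝ) + 1 ≠ 0 := by positivity
    field_simp
    linear_combination this
  rw [chebNode, chebNode, e, Real.sin_pi_div_two_sub, Real.sin_sq_add_cos_sq]

theorem globalMaxPoints_pointConst_of_odd {n : ℕ} (hodd : Odd n) :
    globalMaxPoints (pointConst n (n - 1) ⊤) = {1 / 2} := by
  obtain ⟨m, rfl⟩ := hodd
  have hhalf : chebNode (2 * m + 1) (m + 1) = 1 / 2 := by
    linarith [chebNode_add_chebNode (n := 2 * m + 1) (i := m + 1) (j := m + 1) (by omega)]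
  rw [globalMaxPoints_pointConst (by omega), localMaxPoints_pointConst (by omega)]
  ext a
  constructor
  · rintro ⟨-, h⟩
    have := h _ ⟨m + 1, by omega, by omega, rfl⟩
    rw [hhalf, sub_self, abs_zero] at this
    exact sub_eq_zero.1 (abs_nonpos_iff.1 this)
  · rintro rfl
    refine ⟨⟨m + 1, by omega, by omega, hhalf.symm⟩, fun b _ => ?_⟩
    rw [sub_self, abs_zero]
    exact abs_nonneg _

theorem globalMaxPoints_pointConst_of_even {m : ℕ} (hm : 1 ≤ m) :
    globalMaxPoints (pointConst (2 * m) (2 * m - 1) ⊤) =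
      {chebNode (2 * m) m, chebNode (2 * m) (m + 1)} := by
  have hx := alternatingNodes_chebNode (2 * m)
  have hsum := chebNode_add_chebNode (n := 2 * m) (i := m) (j := m + 1) (by omega)
  have hlt := hx.lt_succ m (by omega)
  have habs : |chebNode (2 * m) m - 1 / 2| = 1 / 2 - chebNode (2 * m) m := by
    rw [abs_of_neg (by linarith)]; ring
  have habs' : |chebNode (2 * m) (m + 1) - 1 / 2| = 1 / 2 - chebNode (2 * m) m := by
    rw [abs_of_pos (by linarith)]; linarith
  have hfar : ∀ j, 1 ≤ j → j ≤ 2 * m → 1 / 2 - chebNode (2 * m) m ≤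
      |chebNode (2 * m) j - 1 / 2| := by
    intro j hj hj'
    rcases le_or_gt j m with h | h
    · have := hx.le h (by omega)
      rw [abs_of_neg (by linarith)]; linarith
    · have := hx.le (show m + 1 ≤ j from h) (by omega)
      rw [abs_of_pos (by linarith)]; linarith
  rw [globalMaxPoints_pointConst (by omega), localMaxPoints_pointConst (by omega)]
  ext a
  constructor
  · rintro ⟨⟨j, hj, hj', rfl⟩, h⟩
    have h1 := h _ ⟨m, by omega, by omega, rfl⟩
    rw [habs] at h1
    rcases lt_trichotomy j m with h2 | rfl | h2
    · have := hx.lt h2 (by omega)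
      rw [abs_of_neg (by linarith)] at h1
      linarith
    · exact Or.inl rfl
    rcases (show m + 1 ≤ j from h2).eq_or_lt with rfl | h3
    · exact Or.inr rfl
    · have := hx.lt h3 (by omega)
      rw [abs_of_pos (by linarith)] at h1
      linarith
  · rintro (rfl | rfl)
    · refine ⟨⟨m, by omega, by omega, rfl⟩, ?_⟩
      rintro b ⟨j, hj, hj', rfl⟩
      rw [habs]
      exact hfar j hj hj'
    · refine ⟨⟨m + 1, by omega, by omega, rfl⟩, ?_⟩
      rintro b ⟨j, hj, hj', rfl⟩
      rw [habs']
      exact hfar j hj hj'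

/-! ### The embedding constant -/

theorem ofReal_abs_le_segNorm_top {f : ℝ → ℝ} (hf : ContinuousOn f (Icc 0 1)) {a : ℝ}
    (ha : a ∈ Ioo (0 : ℝ) 1) : ENNReal.ofReal |f a| ≤ segNorm ⊤ f := by
  by_contra! hlt
  have hcont : ContinuousAt (fun x => ENNReal.ofReal |f x|) a :=
    ENNReal.continuous_ofReal.continuousAt.comp
      (continuous_abs.continuousAt.comp (hf.continuousAt (Icc_mem_nhds ha.1 ha.2)))
  have hae : ∀ᵐ x, x ∈ Icc (0 : ℝ) 1 → ENNReal.ofReal |f x| ≤ segNorm ⊤ f := by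
    rw [← ae_restrict_iff' measurableSet_Icc, segNorm, eLpNorm_exponent_top]
    filter_upwards [ae_le_eLpNormEssSup (f := f)] with x hx
    rwa [Real.enorm_eq_ofReal_abs] at hx
  -- A bound valid almost everywhere holds on a dense set, which meets the neighbourhood where
  -- continuity would violate it.
  obtain ⟨x, hx, hx'⟩ := (Measure.dense_of_ae hae).inter_nhds_nonempty
    (Filter.inter_mem (hcont.eventually (lt_mem_nhds hlt)) (Icc_mem_nhds ha.1 ha.2))
  exact (hx hx'.2).not_gt hx'.1

theorem embeddingConst_eq_pointConst {n : ℕ} (hn : 1 ≤ n) {a : ℝ}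
    (ha : a ∈ globalMaxPoints (pointConst n (n - 1) ⊤)) :
    embeddingConst n (n - 1) ⊤ ⊤ = pointConst n (n - 1) ⊤ a := by
  have hx := alternatingNodes_chebNode n
  refine le_antisymm ?_ ?_
  · refine sSup_le ?_
    rintro r ⟨y, hy, h1, rfl⟩
    rw [segNorm, eLpNorm_exponent_top]
    refine essSup_le_of_ae_le _ ?_
    filter_upwards [ae_restrict_mem measurableSet_Icc] with x hx
    rw [Real.enorm_eq_ofReal_abs]
    exact (le_pointConst_of_memSobolevZero hy h1).trans (ha.2 hx)
  · have hloc := ha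
    rw [globalMaxPoints_pointConst hn, localMaxPoints_pointConst hn] at hloc
    obtain ⟨⟨j, hj, hj', rfl⟩, -⟩ := hloc
    -- The function whose `n`-th derivative changes sign at the Chebyshev nodes attains `A` at every
    -- one of them, so the supremum is reached.
    obtain ⟨y, hy, h1, h2⟩ :=
      exists_memSobolevZero_of_signFn (nodePoly_ne_zero n (chebNode n)) hn hx.orthogonal
    have hI := hx.mem_Ioo hj hj'
    have hval : |segDeriv (n - 1) y (chebNode n j)| = envelopeB n (chebNode n j) := by
      rw [h2 _ (Ioo_subset_Icc_self hI), hx.integral_signFn hj (by omega), abs_neg,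
        alternatingSum_chebNode hj hj', abs_mul, abs_pow, abs_neg, abs_one, one_pow, one_mul,
        abs_of_pos (envelopeB_chebNode_pos hj hj')]
    have hcont : ContinuousOn (segDeriv (n - 1) y) (Icc 0 1) := by
      have := (hy.absolutelyContinuous (n - 1) (by omega)).continuousOn
      rwa [uIcc_of_le zero_le_one] at this
    rw [pointConst_chebNode hn hj hj', ← hval]
    exact (ofReal_abs_le_segNorm_top hcont hI).trans (le_sSup ⟨y, hy, h1, rfl⟩)

theorem embeddingConst_of_odd {n : ℕ} (hodd : Odd n) : embeddingConst n (n - 1) ⊤ ⊤ =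
    ENNReal.ofReal (1 / 2 * Real.tan (Real.pi / (2 * ((n : ℝ) + 1)))) := by
  have hn := hodd.pos
  have hmem : (1 / 2 : ℝ) ∈ globalMaxPoints (pointConst n (n - 1) ⊤) := by
    rw [globalMaxPoints_pointConst_of_odd hodd]; rfl
  have hloc := hmem
  rw [globalMaxPoints_pointConst hn, localMaxPoints_pointConst hn] at hloc
  obtain ⟨⟨j, hj, hj', hja⟩, -⟩ := hloc
  rw [embeddingConst_eq_pointConst hn hmem, hja, pointConst_chebNode hn hj hj', ← hja, envelopeB,
    show (1 / 2 - (1 / 2) ^ 2 : ℝ) = (1 / 2) ^ 2 by norm_num, Real.sqrt_sq (by norm_num), mul_comm]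

theorem embeddingConst_of_even {n : ℕ} (hn : 1 ≤ n) (heven : Even n) :
    embeddingConst n (n - 1) ⊤ ⊤ =
      ENNReal.ofReal (1 / 2 * Real.tan (Real.pi / (2 * ((n : ℝ) + 1))) *
        Real.sin (Real.pi * (n : ℝ) / (2 * ((n : ℝ) + 1)))) := by
  obtain ⟨m, rfl⟩ := heven.two_dvd
  have hmem : chebNode (2 * m) m ∈ globalMaxPoints (pointConst (2 * m) (2 * m - 1) ⊤) := by
    rw [globalMaxPoints_pointConst_of_even (by omega)]; exact Or.inl rfl
  rw [embeddingConst_eq_pointConst hn hmem, pointConst_chebNode hn (by omega) (by omega),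
    envelopeB_chebNode (by omega) (by omega)]
  have e : 2 * (Real.pi * (m : ℝ) / (2 * (((2 * m : ℕ) : ℝ) + 1))) =
      Real.pi * ((2 * m : ℕ) : ℝ) / (2 * (((2 * m : ℕ) : ℝ) + 1)) := by
    push_cast; ring
  rw [e, div_mul_eq_mul_div, mul_comm (1 / 2 : ℝ), mul_one_div, div_mul_eq_mul_div]

theorem mainTheorem1 (n : ℕ) (hn : 1 ≤ n) :
    localMaxPoints (pointConst n (n - 1) ⊤) =
        {a : ℝ | ∃ j : ℕ, 1 ≤ j ∧ j ≤ n ∧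
          a = Real.sin (Real.pi * (j : ℝ) / (2 * ((n : ℝ) + 1))) ^ 2} ∧
    (∀ j : ℕ, 1 ≤ j → j ≤ n →
      pointConst n (n - 1) ⊤ (Real.sin (Real.pi * (j : ℝ) / (2 * ((n : ℝ) + 1))) ^ 2) =
        ENNReal.ofReal
          (envelopeB n (Real.sin (Real.pi * (j : ℝ) / (2 * ((n : ℝ) + 1))) ^ 2))) ∧
    (Odd n → globalMaxPoints (pointConst n (n - 1) ⊤) = {1 / 2}) ∧
    (Even n →
      globalMaxPoints (pointConst n (n - 1) ⊤) =
          {a : ℝ | a ∈ localMaxPoints (pointConst n (n - 1) ⊤) ∧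
            ∀ b ∈ localMaxPoints (pointConst n (n - 1) ⊤), |a - 1 / 2| ≤ |b - 1 / 2|} ∧
      globalMaxPoints (pointConst n (n - 1) ⊤) =
          {Real.sin (Real.pi * (n : ℝ) / (4 * ((n : ℝ) + 1))) ^ 2,
            Real.sin (Real.pi * ((n : ℝ) + 2) / (4 * ((n : ℝ) + 1))) ^ 2}) ∧
    (Odd n → embeddingConst n (n - 1) ⊤ ⊤ =
      ENNReal.ofReal (1 / 2 * Real.tan (Real.pi / (2 * ((n : ℝ) + 1))))) ∧
    (Even n → embeddingConst n (n - 1) ⊤ ⊤ =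
      ENNReal.ofReal (1 / 2 * Real.tan (Real.pi / (2 * ((n : ℝ) + 1))) *
        Real.sin (Real.pi * (n : ℝ) / (2 * ((n : ℝ) + 1))))) := by
  refine ⟨localMaxPoints_pointConst hn, fun j hj hj' => pointConst_chebNode hn hj hj',
    globalMaxPoints_pointConst_of_odd, fun heven => ⟨globalMaxPoints_pointConst hn, ?_⟩,
    embeddingConst_of_odd, embeddingConst_of_even hn⟩
  obtain ⟨m, rfl⟩ := heven.two_dvd
  rw [globalMaxPoints_pointConst_of_even (by omega), chebNode, chebNode]
  have e1 : Real.pi * ((2 * m : ℕ) : ℝ) / (4 * (((2 * m : ℕ) : ℝ) + 1)) =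
      Real.pi * (m : ℝ) / (2 * (((2 * m : ℕ) : ℝ) + 1)) := by
    push_cast; field_simp; ring
  have e2 : Real.pi * (((2 * m : ℕ) : ℝ) + 2) / (4 * (((2 * m : ℕ) : ℝ) + 1)) =
      Real.pi * ((m + 1 : ℕ) : ℝ) / (2 * (((2 * m : ℕ) : ℝ) + 1)) := by
    push_cast; field_simp; ring
  rw [e1, e2]
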